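/- Fix a first order signature $\Sigma=CS\cup FS$ (constructors and function symbols, with arities) and a denumerable set $\mathcal V$ of variables. $Exp$ is the set of first order expressions over $\Sigma$ and $\mathcal V$; $CTerm\subset Exp$ is the set of expressions without function symbols; substitutions are finite mappings, and $CSubst$ is the set of substitutions with values in $CTerm$. $LExp$ extends $Exp$ by (non-recursive) $let\ X=e_1\ in\ e_2$, modulo renaming of bound variables. Composition is written $\sigma\tau$ (first $\sigma$), and $\epsilon$ is the identity. A program $\mathcal P$ is any set of rules $f(p_1,\dots,p_n)\to r$ with $f\in FS$, $(p_1,\dots,p_n)$ a linear tuple of c-terms and $r\in Exp$ (let-free, extra variables allowed). $\mathcal C$ denotes one-hole contexts, and $BV(\mathcal C)$ is the set of let-bound variables visible from the hole. * Term rewriting: $\mathcal C[l\sigma]\to\mathcal C[r\sigma]$ for $(l\to r)\in\mathcal P$ and any substitution $\sigma$. * Narrowing: $\mathcal C[f(\bar t)]\leadsto_\theta\mathcal C\theta[r\theta]$ if $\theta$ is a most general unifier of $f(\bar t)$ and $f(\bar s)$, where $f(\bar s)\to r$ is a fresh variant of a rule of $\mathcal P$. * Let-narrowing $\leadsto^l_\theta$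 on $LExp$: in any context, with $\theta=\epsilon$, $h(\dots,e,\dots)\leadsto let\ X=e\ in\ h(\dots,X,\dots)$ ($X$ fresh, $h\in\Sigma$, $e$ a let-expression or of the form $f(\bar e)$ with $f\in FS$); $let\ X=t\ in\ e\leadsto e[X/t]$ ($t\in CTerm$); $let\ X=e_1\ in\ e_2\leadsto e_2$ ($X$ not free in $e_2$); $let\ X=(let\ Y=e_1\ in\ e_2)\ in\ e_3\leadsto let\ Y=e_1\ in\ let\ X=e_2\ in\ e_3$ ($Y$ not free in $e_3$); and $\mathcal C[f(\bar t)]\leadsto^l_\theta\mathcal C\theta[r\theta]$ for a fresh variant $f(\bar p)\to r$ of a rule of $\mathcal P$ and any $\theta\in CSubst$ with $f(\bar t)\theta\equiv f(\bar p)\theta$, $dom(\theta)\cap BV(\mathcal C)=\emptyset$ and $vRan(\theta|_{\mathcal V\setminus var(\bar p)})\cap BV(\mathcal C)=\emptyset$. In both narrowing relations a variant is fresh if its variables do not occur in the expression $\mathcal C[f(\bar t)]$ that is narrowed. $\leadsto^*_\theta$ and $\leadsto^{l*}_\theta$ denote derivations of zero or more steps, where $\theta$ is the composition of the substitutions of the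 steps ($\epsilon$ for zero steps). Let $\perp$ be a new constant constructor, let $Exp_\perp, CTerm_\perp, CSubst_\perp$ be the corresponding sets over the enlarged signature, and let $\sqsubseteq$ be the least partial order on $Exp_\perp$ that is compatible with contexts and satisfies $\perp\sqsubseteq e$. The CRWL-calculus derives statements $e\rightarrowtriangle t$ by the rules: $e\rightarrowtriangle\perp$; $X\rightarrowtriangle X$ for $X\in\mathcal V$; $c(e_1,\dots,e_n)\rightarrowtriangle c(t_1,\dots,t_n)$ if $e_i\rightarrowtriangle t_i$ for all $i$, with $c$ a constructor; $f(e_1,\dots,e_n)\rightarrowtriangle t$ if $e_i\rightarrowtriangle p_i\theta$ for all $i$ and $r\theta\rightarrowtriangle t$, for some $(f(p_1,\dots,p_n)\to r)\in\mathcal P$ and $\theta\in CSubst_\perp$. $\mathcal P$ is CRWL-deterministic if for every $e\in Exp_\perp$ the set $\{t\in CTerm_\perp\mid e\rightarrowtriangle t\}$ is directed with respect to $\sqsubseteq$. **Theorem.** Let $\mathcal P$ be a program, $e\in Exp$ and $t\in CTerm$. a) For every $\theta\in CSubst$: if $e\leadsto^{l*}_\theta t$, then $e\theta\to^* t$. b)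 If in addition $\mathcal P$ is CRWL-deterministic, then: (b1) For every $\theta\in CSubst$: if $e\theta\to^* t$, then there exist $t'\in CTerm$ and $\sigma,\theta'\in CSubst$ such that $e\leadsto^{l*}_\sigma t'$, $t'\theta'\equiv t$, and $X\sigma\theta'\equiv X\theta$ for all $X\in var(e)$. (b2) For every substitution $\theta$ such that $X\theta\in CTerm$ for all $X\in var(e)$ (in particular for every $\theta\in CSubst$): if $e\leadsto^*_\theta t$, then the conclusion of (b1) holds. -/

import Mathlib

namespace LetNarrowing

/-- A first order signature: constructor symbols and defined function symbols with arities. -/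
structure Signature.{u, v} where
  Con : Type u
  Fun : Type v
  conArity : Con → ℕ
  funArity : Fun → ℕ

/-- All symbols `h` of the signature: constructors (`Sum.inl c`) and functions (`Sum.inr f`). -/
abbrev Signature.Sym (S : Signature) : Type _ := S.Con ⊕ S.Fun

/-- The arity of a symbol. -/
abbrev Signature.arity (S : Signature) : S.Sym → ℕ := Sum.elim S.conArity S.funArity

/-- The signature enlarged with a new constant constructor (namely `none`), the undefined value. -/
abbrev Signature.withBot (S : Signature) : Signature where
  Con := Option S.Con
  Fun := S.Fun
  conArity := fun o => o.elim 0 S.conArity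
  funArity := S.funArity

/-- Expressions over the signature `S` with variables in `X`. -/
inductive Exp (S : Signature) (X : Type*) : Type _
  | var (x : X) : Exp S X
  | app (h : S.Sym) (es : Fin (S.arity h) → Exp S X) : Exp S X

namespace Exp

variable {S : Signature} {X Y : Type*}

/-- Constructed terms: expressions without defined function symbols. -/
inductive IsCTerm : Exp S X → Prop
  | var (x : X) : IsCTerm (.var x)
  | con (c : S.Con) (ts : Fin (S.arity (.inl c)) → Exp S X) (h : ∀ i, IsCTerm (ts i)) :
      IsCTerm (.app (.inl c) ts)

/-- The list of all occurrences of variables, from left to right. -/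
def varList : Exp S X → List X
  | .var x => [x]
  | .app _ es => (List.ofFn fun i => (es i).varList).flatten

/-- The set of variables occurring in an expression. -/
def vars (e : Exp S X) : Set X := {x | x ∈ e.varList}

/-- Application of a mapping from variables to expressions. -/
def subst (σ : X → Exp S Y) : Exp S X → Exp S Y
  | .var x => σ x
  | .app h es => .app h fun i => (es i).subst σ

/-- Renaming of variables. -/
def map (ρ : X → Y) (e : Exp S X) : Exp S Y := e.subst fun x => .var (ρ x)

/-- Every expression is a partial expression. -/
def toPartial : Exp S X → Exp S.withBot X
  | .var x => .var x
  | .app (.inl c) es => .app (.inl (some c)) fun i => (es i).toPartial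
  | .app (.inr f) es => .app (.inr f) fun i => (es i).toPartial

/-- The undefined value, as a partial expression. -/
def bot : Exp S.withBot X := .app (.inl none) Fin.elim0

/-- The approximation ordering of partial expressions: the least partial ordering that has `bot`
as its least element and is compatible with all symbols (equivalently, with all contexts). -/
inductive Approx : Exp S.withBot X → Exp S.withBot X → Prop
  | bot (e : Exp S.withBot X) : Approx bot e
  | var (x : X) : Approx (.var x) (.var x)
  | app (h : S.withBot.Sym) (es es' : Fin (S.withBot.arity h) → Exp S.withBot X)
      (H : ∀ i, Approx (es i) (es' i)) : Approx (.app h es) (.app h es')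

end Exp

section Substitutions

variable {S : Signature} {V : Type*}

/-- The domain of a substitution. -/
def substDom (σ : V → Exp S V) : Set V := {x | σ x ≠ .var x}

/-- Substitutions are finite mappings: they move only finitely many variables. -/
def IsSubst (σ : V → Exp S V) : Prop := (substDom σ).Finite

/-- A c-substitution maps every variable to a c-term. -/
def IsCSubst (σ : V → Exp S V) : Prop := IsSubst σ ∧ ∀ x, (σ x).IsCTerm

/-- The composition `σ τ`: first `σ`, then `τ`. -/
def substComp (σ τ : V → Exp S V) : V → Exp S V := fun x => (σ x).subst τ

end Substitutions

/-- A rewrite rule `f(p₁, …, pₙ) → r` with `f` a defined function symbol. -/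
structure Rule (S : Signature) (V : Type*) where
  f : S.Fun
  args : Fin (S.arity (.inr f)) → Exp S V
  rhs : Exp S V

namespace Rule

variable {S : Signature} {V : Type*}

/-- The left-hand side `f(p₁, …, pₙ)`. -/
def lhs (R : Rule S V) : Exp S V := .app (.inr R.f) R.args

/-- The variables of a rule. -/
def vars (R : Rule S V) : Set V := R.lhs.vars ∪ R.rhs.vars

/-- Renaming of a rule by a bijection of the variables. -/
def rename (ρ : Equiv.Perm V) (R : Rule S V) : Rule S V where
  f := R.f
  args := fun i => (R.args i).map ρ
  rhs := R.rhs.map ρ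

/-- `R'` is a variant of the rule `R`. -/
def IsVariant (R' R : Rule S V) : Prop := ∃ ρ : Equiv.Perm V, R' = R.rename ρ

/-- Program rules: the arguments of the left-hand side form a linear tuple of c-terms (no variable
occurs twice in it). The right-hand side may have extra variables. -/
def IsProgramRule (R : Rule S V) : Prop :=
  (∀ i, (R.args i).IsCTerm) ∧ R.lhs.varList.Nodup

end Rule

/-- A program is any set of program rules. -/
def IsProgram {S : Signature} {V : Type*} (P : Set (Rule S V)) : Prop :=
  ∀ R ∈ P, R.IsProgramRule

/-! ### Term rewriting and narrowing -/

/-- One-hole contexts. In `app h es i C` the argument number `i` is the one that contains the hole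
(the entry `es i` is ignored). -/
inductive Ctx (S : Signature) (V : Type*) : Type _
  | hole : Ctx S V
  | app (h : S.Sym) (es : Fin (S.arity h) → Exp S V) (i : Fin (S.arity h)) (C : Ctx S V) : Ctx S V

namespace Ctx

variable {S : Signature} {V : Type*}

/-- `C[e]` -/
def fill : Ctx S V → Exp S V → Exp S V
  | .hole, e => e
  | .app h es i C, e => .app h (Function.update es i (C.fill e))

/-- `Cσ` -/
def subst (σ : V → Exp S V) : Ctx S V → Ctx S V
  | .hole => .hole
  | .app h es i C => .app h (fun j => (es j).subst σ) i (C.subst σ)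

end Ctx

section TermRewriting

variable {S : Signature} {V : Type*}

/-- Term rewriting: `C[lσ] → C[rσ]` for a rule `l → r`, a context `C` and a substitution `σ`. -/
inductive RwStep (P : Set (Rule S V)) : Exp S V → Exp S V → Prop
  | mk (C : Ctx S V) (R : Rule S V) (hR : R ∈ P) (σ : V → Exp S V) (hσ : IsSubst σ) :
      RwStep P (C.fill (R.lhs.subst σ)) (C.fill (R.rhs.subst σ))

/-- The reflexive and transitive closure of term rewriting. -/
def RwSteps (P : Set (Rule S V)) : Exp S V → Exp S V → Prop := Relation.ReflTransGen (RwStep P)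

/-- `θ` is a most general unifier of `e₁` and `e₂`. -/
def IsMGU (θ : V → Exp S V) (e₁ e₂ : Exp S V) : Prop :=
  IsSubst θ ∧ e₁.subst θ = e₂.subst θ ∧
    ∀ τ : V → Exp S V, IsSubst τ → e₁.subst τ = e₂.subst τ →
      ∃ μ : V → Exp S V, IsSubst μ ∧ τ = substComp θ μ

/-- Ordinary narrowing: `C[f(t̄)] ⇝_θ Cθ[rθ]` for `θ` a most general unifier of `f(t̄)` and the
left-hand side of a fresh variant `f(s̄) → r` of a rule. -/
inductive NarrStep (P : Set (Rule S V)) : Exp S V → (V → Exp S V) → Exp S V → Prop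
  | mk (C : Ctx S V) (R R' : Rule S V) (hR : R ∈ P) (hvar : R'.IsVariant R)
      (ts : Fin (S.arity (.inr R'.f)) → Exp S V)
      (hfresh : Disjoint R'.vars (C.fill (.app (.inr R'.f) ts)).vars)
      (θ : V → Exp S V) (hθ : IsMGU θ (.app (.inr R'.f) ts) R'.lhs) :
      NarrStep P (C.fill (.app (.inr R'.f) ts)) θ ((C.subst θ).fill (R'.rhs.subst θ))

/-- Narrowing derivations, labelled by the composition of the substitutions of their steps. -/
inductive NarrSteps (P : Set (Rule S V)) : Exp S V → (V → Exp S V) → Exp S V → Prop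
  | refl (e : Exp S V) : NarrSteps P e Exp.var e
  | head {e e₁ e' : Exp S V} {θ₁ θ₂ : V → Exp S V} (h₁ : NarrStep P e θ₁ e₁)
      (h₂ : NarrSteps P e₁ θ₂ e') : NarrSteps P e (substComp θ₁ θ₂) e'

end TermRewriting

/-! ### The CRWL calculus and determinism -/

section CRWLCalculus

variable {S : Signature} {V : Type*}

/-- The CRWL proof calculus. -/
inductive CRWL (P : Set (Rule S V)) : Exp S.withBot V → Exp S.withBot V → Prop
  | B (e : Exp S.withBot V) : CRWL P e Exp.bot
  | RR (x : V) : CRWL P (.var x) (.var x)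
  | DC (c : S.withBot.Con) (es ts : Fin (S.withBot.arity (.inl c)) → Exp S.withBot V)
      (h : ∀ i, CRWL P (es i) (ts i)) : CRWL P (.app (.inl c) es) (.app (.inl c) ts)
  | OR (R : Rule S V) (hR : R ∈ P) (θ : V → Exp S.withBot V) (hθ : IsCSubst θ)
      (es : Fin (S.withBot.arity (.inr R.f)) → Exp S.withBot V) (t : Exp S.withBot V)
      (hargs : ∀ i, CRWL P (es i) ((R.args i).toPartial.subst θ))
      (hrhs : CRWL P (R.rhs.toPartial.subst θ) t) : CRWL P (.app (.inr R.f) es) t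

/-- The CRWL-denotation of a partial expression: a set of partial c-terms. -/
def den (P : Set (Rule S V)) (e : Exp S.withBot V) : Set (Exp S.withBot V) :=
  {t | t.IsCTerm ∧ CRWL P e t}

/-- CRWL-deterministic programs: the denotation of every partial expression is directed. -/
def CRWLDeterministic (P : Set (Rule S V)) : Prop :=
  ∀ e : Exp S.withBot V, DirectedOn Exp.Approx (den P e)

end CRWLCalculus

/-! ### Let-expressions

Let-expressions are taken modulo renaming of bound variables. To this end, occurrences of let-bound
variables are represented by de Bruijn indices, while all other variables are elements of `V`. -/

/-- Let-expressions in the scope of `n` let-bindings. A variable is either `Sum.inl x` with `x : V`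
a free variable, or `Sum.inr i` with `i : Fin n` a variable bound by a surrounding let (`0` is the
innermost one). `letIn a b` is `let X = a in b` with `X` the variable of index `0` of `b`; lets are
not recursive, so `X` is not visible in `a`. -/
inductive LExp (S : Signature) (V : Type*) : ℕ → Type _
  | var {n : ℕ} (x : V ⊕ Fin n) : LExp S V n
  | app {n : ℕ} (h : S.Sym) (es : Fin (S.arity h) → LExp S V n) : LExp S V n
  | letIn {n : ℕ} (a : LExp S V n) (b : LExp S V (n + 1)) : LExp S V n

section LetExpressions

variable {S : Signature} {V : Type*}

/-- Let-free expressions (possibly with let-bound variables of the context) as let-expressions. -/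
def Exp.toLExp {n : ℕ} : Exp S (V ⊕ Fin n) → LExp S V n
  | .var x => .var x
  | .app h es => .app h fun i => (es i).toLExp

/-- `Exp` as a subset of the let-expressions. -/
def Exp.inLExp (e : Exp S V) : LExp S V 0 := (e.map Sum.inl).toLExp

/-- The variables seen from below one more let. -/
def shift {n : ℕ} : V ⊕ Fin n → V ⊕ Fin (n + 1) := Sum.map id Fin.succ

/-- Pushing a mapping from variables to expressions below a let. -/
def liftSubst {m n : ℕ} (σ : V ⊕ Fin m → Exp S (V ⊕ Fin n)) :
    V ⊕ Fin (m + 1) → Exp S (V ⊕ Fin (n + 1)) :=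
  Sum.elim (fun x => (σ (.inl x)).map shift)
    (Fin.cases (.var (.inr 0)) fun i => (σ (.inr i)).map shift)

namespace LExp

/-- Capture-avoiding simultaneous replacement of all visible variables by (let-free) expressions. -/
def bind {m n : ℕ} (e : LExp S V m) (σ : V ⊕ Fin m → Exp S (V ⊕ Fin n)) : LExp S V n :=
  match e with
  | .var x => (σ x).toLExp
  | .app h es => .app h fun i => (es i).bind σ
  | .letIn a b => .letIn (a.bind σ) (b.bind (liftSubst σ))

/-- The application `eθ` of a substitution to the free variables of a let-expression. -/
def subst {n : ℕ} (θ : V → Exp S V) (e : LExp S V n) : LExp S V n :=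
  e.bind (Sum.elim (fun x => (θ x).map .inl) fun i => .var (.inr i))

/-- The same let-expression below one more let. -/
def weaken {n : ℕ} (e : LExp S V n) : LExp S V (n + 1) := e.bind fun x => .var (shift x)

/-- The same expression below one more let, inserted just outside of the innermost one. -/
def weakenUnder {n : ℕ} (e : LExp S V (n + 1)) : LExp S V (n + 2) :=
  e.bind (liftSubst fun x => .var (shift x))

/-- `e[X/t]` for `X` the innermost let-bound variable. -/
def inst {n : ℕ} (e : LExp S V (n + 1)) (t : Exp S (V ⊕ Fin n)) : LExp S V n :=
  e.bind (Sum.elim (fun x => .var (.inl x)) (Fin.cases t fun i => .var (.inr i)))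

/-- The set `FV(e)` of free variables. -/
def FV {n : ℕ} : LExp S V n → Set V
  | .var (.inl x) => {x}
  | .var (.inr _) => ∅
  | .app _ es => ⋃ i, (es i).FV
  | .letIn a b => a.FV ∪ b.FV

/-- Expressions `f(ē)` with `f` a defined function symbol, or `let Y = e' in e''`. -/
def IsSuspendable {n : ℕ} : LExp S V n → Prop
  | .app (.inr _) _ => True
  | .letIn _ _ => True
  | _ => False

/-- Gives the names `ν` to the let-bound variables of the surrounding scope. -/
def openWith {n : ℕ} (ν : Fin n → V) (e : LExp S V n) : LExp S V 0 :=
  e.bind (Sum.elim (fun x => .var (.inl x)) fun i => .var (.inl (ν i)))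

end LExp

open Classical in
/-- Turns the names `ν` back into let-bound variables of the surrounding scope. -/
noncomputable def Exp.closeWith {n : ℕ} (ν : Fin n → V) (e : Exp S V) : Exp S (V ⊕ Fin n) :=
  e.map fun x => if h : ∃ i, ν i = x then .inr h.choose else .inl x

/-- One-hole contexts with lets. `LCtx S V m n` are the contexts in the scope of `n` let-bindings
whose hole is in the scope of `m` let-bindings. In particular, for a context `C : LCtx S V m 0` the
set `BV(C)` of let-bound variables visible from the hole consists of the `m` variables
`Sum.inr i`, `i : Fin m`. In `app h es i C` the entry `es i` is ignored. -/
inductive LCtx (S : Signature) (V : Type*) (m : ℕ) : ℕ → Type _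
  | hole : LCtx S V m m
  | app {n : ℕ} (h : S.Sym) (es : Fin (S.arity h) → LExp S V n) (i : Fin (S.arity h))
      (C : LCtx S V m n) : LCtx S V m n
  | letDef {n : ℕ} (C : LCtx S V m n) (b : LExp S V (n + 1)) : LCtx S V m n
  | letBody {n : ℕ} (a : LExp S V n) (C : LCtx S V m (n + 1)) : LCtx S V m n

namespace LCtx

/-- `C[e]` -/
def fill {m n : ℕ} : LCtx S V m n → LExp S V m → LExp S V n
  | .hole, e => e
  | .app h es i C, e => .app h (Function.update es i (C.fill e))
  | .letDef C b, e => .letIn (C.fill e) b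
  | .letBody a C, e => .letIn a (C.fill e)

/-- `Cθ` -/
def subst {m n : ℕ} (θ : V → Exp S V) : LCtx S V m n → LCtx S V m n
  | .hole => .hole
  | .app h es i C => .app h (fun j => (es j).subst θ) i (C.subst θ)
  | .letDef C b => .letDef (C.subst θ) (b.subst θ)
  | .letBody a C => .letBody (a.subst θ) (C.subst θ)

end LCtx

/-! ### Let-narrowing -/

/-- The rules of let-rewriting that do not use the program, at the root of an expression. The
requirements that new bound variables are fresh and that no free variable is captured are built into
the representation of bound variables. -/
inductive PeelStep : {n : ℕ} → LExp S V n → LExp S V n → Prop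
  /-- `h(…, e, …) → let X = e in h(…, X, …)` if `e` is `f(ē)` or a let-expression, `X` fresh. -/
  | letIn {n : ℕ} (h : S.Sym) (es : Fin (S.arity h) → LExp S V n) (i : Fin (S.arity h))
      (hi : (es i).IsSuspendable) :
      PeelStep (.app h es)
        (.letIn (es i) (.app h (Function.update (fun j => (es j).weaken) i (.var (.inr 0)))))
  /-- `let X = t in e → e[X/t]` if `t` is a c-term. -/
  | bind {n : ℕ} (t : Exp S (V ⊕ Fin n)) (ht : t.IsCTerm) (e : LExp S V (n + 1)) :
      PeelStep (.letIn t.toLExp e) (e.inst t)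
  /-- `let X = e₁ in e₂ → e₂` if `X` is not free in `e₂`. -/
  | elim {n : ℕ} (e₁ e₂ : LExp S V n) : PeelStep (.letIn e₁ e₂.weaken) e₂
  /-- `let X = (let Y = e₁ in e₂) in e₃ → let Y = e₁ in (let X = e₂ in e₃)` if `Y` is not free
  in `e₃`. -/
  | flat {n : ℕ} (e₁ : LExp S V n) (e₂ e₃ : LExp S V (n + 1)) :
      PeelStep (.letIn (.letIn e₁ e₂) e₃) (.letIn e₁ (.letIn e₂ e₃.weakenUnder))

/-- One step of let-narrowing, `e ⇝_θ e'`.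

`peel`: a step by one of the rules LetIn, Bind, Elim, Flat in an arbitrary context, decorated with
the empty substitution.

`narr`: a step `C[f(t̄)] ⇝_θ Cθ[rθ]` in an arbitrary (possibly empty) context, where `f(p̄) → r` is a
fresh variant of a program rule and `θ` is a c-substitution with `f(t̄)θ ≡ f(p̄)θ`. Here `ν` names the
variables in `BV(C)`; as always, bound variables are named apart from each other and from the free
variables. The conditions `hdom` and `hran` are `dom(θ) ∩ BV(C) = ∅` and
`vRan(θ|_{∖var(p̄)}) ∩ BV(C) = ∅`. -/
inductive LetNarrStep (P : Set (Rule S V)) : LExp S V 0 → (V → Exp S V) → LExp S V 0 → Prop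
  | peel {m : ℕ} (C : LCtx S V m 0) (a b : LExp S V m) (h : PeelStep a b) :
      LetNarrStep P (C.fill a) Exp.var (C.fill b)
  | narr {m : ℕ} (C : LCtx S V m 0) (R R' : Rule S V) (hR : R ∈ P) (hvar : R'.IsVariant R)
      (ts : Fin (S.arity (.inr R'.f)) → LExp S V m)
      (ν : Fin m → V) (hν : Function.Injective ν)
      (hνFV : Disjoint (Set.range ν) (C.fill (.app (.inr R'.f) ts)).FV)
      (hfresh : Disjoint R'.vars ((C.fill (.app (.inr R'.f) ts)).FV ∪ Set.range ν))
      (θ : V → Exp S V) (hθ : IsCSubst θ)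
      (hunif : ((LExp.app (.inr R'.f) ts).openWith ν).subst θ = (R'.lhs.subst θ).inLExp)
      (hdom : Disjoint (substDom θ) (Set.range ν))
      (hran : ∀ x ∈ substDom θ, x ∉ R'.lhs.vars → Disjoint (θ x).vars (Set.range ν)) :
      LetNarrStep P (C.fill (.app (.inr R'.f) ts)) θ
        ((C.subst θ).fill ((R'.rhs.subst θ).closeWith ν).toLExp)

/-- Let-narrowing derivations, labelled by the composition of the substitutions of their steps. -/
inductive LetNarrSteps (P : Set (Rule S V)) : LExp S V 0 → (V → Exp S V) → LExp S V 0 → Prop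
  | refl (e : LExp S V 0) : LetNarrSteps P e Exp.var e
  | head {e e₁ e' : LExp S V 0} {θ₁ θ₂ : V → Exp S V} (h₁ : LetNarrStep P e θ₁ e₁)
      (h₂ : LetNarrSteps P e₁ θ₂ e') : LetNarrSteps P e (substComp θ₁ θ₂) e'

end LetExpressions

end LetNarrowing

/-! Soundness. Replacing every let by substitution of its definition (`LExp.unfold`) turns
let-expressions into ordinary ones. The peeling rules LetIn, Bind, Elim and Flat do not change the
unfolding, and a narrowing step with substitution `θ` becomes a rewriting of the `θ`-instance, in as
many steps as the unfolding copies the narrowed call. Stability of rewriting under substitution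
composes the steps (`LetNarrSteps.unfold_rwSteps`).

Completeness has two halves. Rewriting may copy an unevaluated argument and give the copies
different values, whereas lets share one value. Determinism removes this difference: the values used
at the various occurrences of a variable have a common upper bound that is again a value
(`CRWLDeterministic.exists_values`). Hence CRWL values can be pulled back along rewrite steps, and a
c-term reached by rewriting is a CRWL value (`CRWLDeterministic.crwl_of_rwSteps`).

The second half needs no determinism. CRWL derivations are transferred to a semantics `LSem` of
let-expressions that bounds the number of rule applications. Peeling preserves value and bound, and
terminates in a list of flat calls followed by a c-term or a flat call. There, either no binding is
needed and all can be discarded, or some call has a defined value while all variables bound around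
it may be taken as undefined (`PeelNF.progress`). Undefined variables cannot contribute a
constructor, so the arguments, instantiated by `θ`, match the linear left-hand side syntactically.
Since let-narrowing admits any unifying c-substitution, the step applies all of `θ` at once
(`exists_letNarrStep`), and the bound drops. Induction on this bound and on a peeling weight gives
`LSem.exists_letNarrSteps`.

Ordinary narrowing is sound for rewriting, so (b2) reduces to (b1). -/

namespace LetNarrowing

variable {S : Signature} {V X Y Z A : Type*} {n m : ℕ}

/-! ### Expressions -/

namespace Exp

theorem mem_vars_var {x y : X} : y ∈ (Exp.var x : Exp S X).vars ↔ y = x := by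
  simp [vars, varList]

theorem mem_vars_app {h : S.Sym} {es : Fin (S.arity h) → Exp S X} {y : X} :
    y ∈ (Exp.app h es).vars ↔ ∃ i, y ∈ (es i).vars := by
  simp [vars, varList, List.mem_flatten, List.mem_ofFn]

theorem finite_vars (e : Exp S X) : e.vars.Finite := List.finite_toSet _

theorem subst_congr {σ τ : X → Exp S Y} (e : Exp S X) (h : ∀ x ∈ e.vars, σ x = τ x) :
    e.subst σ = e.subst τ := by
  induction e with
  | var x => exact h x (mem_vars_var.2 rfl)
  | app f es ih =>
    simp only [subst]
    congr 1
    funext i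
    exact ih i fun x hx => h x (mem_vars_app.2 ⟨i, hx⟩)

theorem subst_subst (σ : X → Exp S Y) (τ : Y → Exp S Z) (e : Exp S X) :
    (e.subst σ).subst τ = e.subst fun x => (σ x).subst τ := by
  induction e with
  | var x => rfl
  | app f es ih => simp [subst, ih]

theorem subst_var (e : Exp S X) : e.subst Exp.var = e := by
  induction e with
  | var x => rfl
  | app f es ih => simp [subst, ih]

theorem map_subst (ρ : X → Y) (τ : Y → Exp S Z) (e : Exp S X) :
    (e.map ρ).subst τ = e.subst fun x => τ (ρ x) := subst_subst _ _ _

theorem subst_map (σ : X → Exp S Y) (ρ : Y → Z) (e : Exp S X) :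
    (e.subst σ).map ρ = e.subst fun x => (σ x).map ρ := subst_subst _ _ _

theorem map_map (ρ : X → Y) (π : Y → Z) (e : Exp S X) :
    (e.map ρ).map π = e.map fun x => π (ρ x) := subst_subst _ _ _

theorem subst_eq_self {σ : X → Exp S X} (e : Exp S X) (h : ∀ x ∈ e.vars, σ x = .var x) :
    e.subst σ = e :=
  (subst_congr e h).trans (subst_var e)

theorem mem_vars_subst {σ : X → Exp S Y} {e : Exp S X} {y : Y} :
    y ∈ (e.subst σ).vars ↔ ∃ x ∈ e.vars, y ∈ (σ x).vars := by
  induction e with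
  | var x => simp [subst, mem_vars_var]
  | app f es ih =>
    simp only [subst, mem_vars_app, ih]
    constructor
    · rintro ⟨i, x, hx, hy⟩
      exact ⟨x, ⟨i, hx⟩, hy⟩
    · rintro ⟨x, ⟨i, hx⟩, hy⟩
      exact ⟨i, x, hx, hy⟩

theorem mem_vars_map {ρ : X → Y} {e : Exp S X} {y : Y} :
    y ∈ (e.map ρ).vars ↔ ∃ x ∈ e.vars, ρ x = y := by
  simp only [map, mem_vars_subst, mem_vars_var, eq_comm]

theorem isCTerm_con_iff {c : S.Con} {es : Fin (S.arity (.inl c)) → Exp S X} :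
    (Exp.app (.inl c) es).IsCTerm ↔ ∀ i, (es i).IsCTerm :=
  ⟨fun h => by cases h with | con _ _ h => exact h, .con c es⟩

theorem not_isCTerm_fun {f : S.Fun} {es : Fin (S.arity (.inr f)) → Exp S X} :
    ¬ (Exp.app (.inr f) es).IsCTerm := fun h => by cases h

theorem IsCTerm.subst {σ : X → Exp S Y} {e : Exp S X} (he : e.IsCTerm)
    (hσ : ∀ x ∈ e.vars, (σ x).IsCTerm) : (e.subst σ).IsCTerm := by
  induction he with
  | var x => exact hσ x (mem_vars_var.2 rfl)
  | con c es _ ih => exact .con c _ fun i => ih i fun x hx => hσ x (mem_vars_app.2 ⟨i, hx⟩)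

theorem IsCTerm.map {ρ : X → Y} {e : Exp S X} (he : e.IsCTerm) : (e.map ρ).IsCTerm :=
  he.subst fun _ _ => .var _

theorem IsCTerm.of_subst {σ : X → Exp S Y} {e : Exp S X} (h : (e.subst σ).IsCTerm) :
    ∀ x ∈ e.vars, (σ x).IsCTerm := by
  induction e with
  | var x => intro y hy; rw [mem_vars_var.1 hy]; exact h
  | app f es ih =>
    intro x hx
    obtain ⟨i, hi⟩ := mem_vars_app.1 hx
    rcases f with c | f
    · exact ih i (isCTerm_con_iff.1 h i) x hi
    · exact (not_isCTerm_fun h).elim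

theorem toPartial_subst (σ : X → Exp S Y) (e : Exp S X) :
    (e.subst σ).toPartial = e.toPartial.subst fun x => (σ x).toPartial := by
  induction e with
  | var x => rfl
  | app f es ih =>
    rcases f with c | f
    · exact congrArg (Exp.app (S := S.withBot) (.inl (some c))) (funext ih)
    · exact congrArg (Exp.app (S := S.withBot) (.inr f)) (funext ih)

theorem vars_toPartial (e : Exp S X) : e.toPartial.vars = e.vars := by
  ext y
  induction e with
  | var x => simp [toPartial, mem_vars_var]
  | app f es ih => rcases f with c | f <;> simp only [toPartial, mem_vars_app] <;>
      exact exists_congr ih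

theorem IsCTerm.toPartial {e : Exp S X} (he : e.IsCTerm) : e.toPartial.IsCTerm := by
  induction he with
  | var x => exact .var x
  | con c es _ ih => exact .con (S := S.withBot) (some c) _ ih

theorem isCTerm_bot : (bot : Exp S.withBot X).IsCTerm :=
  .con (S := S.withBot) none _ fun i => i.elim0

theorem toPartial_ne_bot (e : Exp S X) : e.toPartial ≠ bot := by
  intro h
  rcases e with x | ⟨c | f, es⟩ <;> simp only [Exp.toPartial, bot] at h
  · cases h
  · injection h with h; cases h
  · injection h with h; cases h

theorem app_none_eq_bot (es : Fin (S.withBot.arity (.inl none)) → Exp S.withBot X) :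
    Exp.app (.inl none) es = bot := by
  unfold bot
  congr 1
  funext i
  exact i.elim0

/-! ### The approximation ordering -/

theorem Approx.refl (e : Exp S.withBot X) : Approx e e := by
  induction e with
  | var x => exact .var x
  | app h es ih => exact .app h es es ih

theorem approx_bot_iff {e : Exp S.withBot X} : Approx e bot ↔ e = bot := by
  constructor
  · intro h
    unfold bot at h
    cases h with
    | bot => rfl
    | app _ es _ _ => exact app_none_eq_bot es
  · rintro rfl
    exact .bot _

theorem approx_var_iff {e : Exp S.withBot X} {x : X} :
    Approx e (.var x) ↔ e = bot ∨ e = .var x := by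
  constructor
  · intro h
    cases h with
    | bot => exact .inl rfl
    | var => exact .inr rfl
  · rintro (rfl | rfl)
    · exact .bot _
    · exact .var _

theorem approx_app_iff {e : Exp S.withBot X} {h : S.withBot.Sym}
    {es : Fin (S.withBot.arity h) → Exp S.withBot X} :
    Approx e (.app h es) ↔
      e = bot ∨ ∃ es', e = .app h es' ∧ ∀ i, Approx (es' i) (es i) := by
  constructor
  · intro H
    cases H with
    | bot => exact .inl rfl
    | app _ es' _ H => exact .inr ⟨es', rfl, H⟩
  · rintro (rfl | ⟨es', rfl, H⟩)
    · exact .bot _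
    · exact .app _ _ _ H

theorem Approx.trans {a b c : Exp S.withBot X} (h₁ : Approx a b) (h₂ : Approx b c) :
    Approx a c := by
  induction h₂ generalizing a with
  | bot e => rw [approx_bot_iff.1 h₁]; exact .bot _
  | var x => exact h₁
  | app h es es' _ ih =>
    rcases approx_app_iff.1 h₁ with rfl | ⟨es'', rfl, H⟩
    · exact .bot _
    · exact .app _ _ _ fun i => ih i (H i)

theorem Approx.subst {σ τ : X → Exp S.withBot Y} (e : Exp S.withBot X)
    (h : ∀ x ∈ e.vars, Approx (σ x) (τ x)) : Approx (e.subst σ) (e.subst τ) := by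
  induction e with
  | var x => exact h x (mem_vars_var.2 rfl)
  | app f es ih => exact .app _ _ _ fun i => ih i fun x hx => h x (mem_vars_app.2 ⟨i, hx⟩)

end Exp

/-! ### Substitutions and rules -/

theorem isSubst_var : IsSubst (Exp.var : V → Exp S V) := by
  simp [IsSubst, substDom]

theorem isCSubst_var : IsCSubst (Exp.var : V → Exp S V) :=
  ⟨isSubst_var, fun x => .var x⟩

theorem IsSubst.comp {σ τ : V → Exp S V} (hσ : IsSubst σ) (hτ : IsSubst τ) :
    IsSubst (substComp σ τ) := by
  refine (Set.Finite.union hσ hτ).subset fun x hx => ?_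
  by_contra h
  simp only [substDom, Set.mem_union, Set.mem_ofPred_eq, not_or, not_not] at h
  exact hx (by simp [substComp, h.1, Exp.subst, h.2])

theorem IsCSubst.comp {σ τ : V → Exp S V} (hσ : IsCSubst σ) (hτ : IsCSubst τ) :
    IsCSubst (substComp σ τ) :=
  ⟨hσ.1.comp hτ.1, fun x => (hσ.2 x).subst fun y _ => hτ.2 y⟩

open Classical in
/-- The substitution that agrees with `σ` on `s` and moves no other variable. -/
noncomputable def restrictSubst (s : Set V) (σ : V → Exp S V) : V → Exp S V :=
  fun x => if x ∈ s then σ x else .var x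

theorem restrictSubst_of_mem {s : Set V} {σ : V → Exp S V} {x : V} (hx : x ∈ s) :
    restrictSubst s σ x = σ x := if_pos hx

theorem isSubst_restrictSubst {s : Set V} (hs : s.Finite) (σ : V → Exp S V) :
    IsSubst (restrictSubst s σ) :=
  hs.subset fun x hx => by
    by_contra h
    exact hx (if_neg h)

theorem isCSubst_restrictSubst {s : Set V} (hs : s.Finite) {σ : V → Exp S V}
    (hσ : ∀ x ∈ s, (σ x).IsCTerm) : IsCSubst (restrictSubst s σ) := by
  refine ⟨isSubst_restrictSubst hs σ, fun x => ?_⟩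
  by_cases hx : x ∈ s
  · rw [restrictSubst_of_mem hx]; exact hσ x hx
  · rw [restrictSubst, if_neg hx]; exact .var x

namespace Rule

theorem finite_vars (R : Rule S V) : R.vars.Finite :=
  (Exp.finite_vars _).union (Exp.finite_vars _)

theorem lhs_rename (ρ : Equiv.Perm V) (R : Rule S V) : (R.rename ρ).lhs = R.lhs.map ρ := rfl

theorem mem_vars_rename {ρ : Equiv.Perm V} {R : Rule S V} {x : V} :
    x ∈ (R.rename ρ).vars ↔ ρ.symm x ∈ R.vars := by
  simp only [vars, lhs_rename, Set.mem_union, Exp.mem_vars_map,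
    show (R.rename ρ).rhs = R.rhs.map ρ from rfl, ← Equiv.eq_symm_apply, exists_eq_right]

theorem mem_lhs_vars_rename {ρ : Equiv.Perm V} {R : Rule S V} {x : V} :
    x ∈ (R.rename ρ).lhs.vars ↔ ρ.symm x ∈ R.lhs.vars := by
  simp only [lhs_rename, Exp.mem_vars_map, ← Equiv.eq_symm_apply, exists_eq_right]

end Rule

/-! ### Term rewriting -/

theorem RwStep.app {P : Set (Rule S V)} {h : S.Sym} (es : Fin (S.arity h) → Exp S V)
    (i : Fin (S.arity h)) {a b : Exp S V} (H : RwStep P a b) :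
    RwStep P (.app h (Function.update es i a)) (.app h (Function.update es i b)) := by
  cases H with
  | mk C R hR σ hσ => exact .mk (.app h es i C) R hR σ hσ

/-- Only the finitely many variables of the rule matter, so finiteness of the matching substitution
is no restriction. This allows arbitrary valuations as matching substitutions. -/
theorem RwStep.root {P : Set (Rule S V)} {R : Rule S V} (hR : R ∈ P) (σ : V → Exp S V) :
    RwStep P (R.lhs.subst σ) (R.rhs.subst σ) := by
  have h := RwStep.mk .hole R hR (restrictSubst R.vars σ) (isSubst_restrictSubst R.finite_vars σ)
  have hl := Exp.subst_congr (σ := restrictSubst R.vars σ) (τ := σ) R.lhs fun x hx =>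
    restrictSubst_of_mem (Set.mem_union_left _ hx)
  have hr := Exp.subst_congr (σ := restrictSubst R.vars σ) (τ := σ) R.rhs fun x hx =>
    restrictSubst_of_mem (Set.mem_union_right _ hx)
  rwa [hl, hr] at h

theorem RwStep.root_variant {P : Set (Rule S V)} {R R' : Rule S V} (hR : R ∈ P)
    (h : R'.IsVariant R) (σ : V → Exp S V) : RwStep P (R'.lhs.subst σ) (R'.rhs.subst σ) := by
  obtain ⟨ρ, rfl⟩ := h
  rw [Rule.lhs_rename, show (R.rename ρ).rhs = R.rhs.map ρ from rfl, Exp.map_subst, Exp.map_subst]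
  exact .root hR _

theorem RwStep.fill {P : Set (Rule S V)} (C : Ctx S V) {a b : Exp S V} (H : RwStep P a b) :
    RwStep P (C.fill a) (C.fill b) := by
  induction C with
  | hole => exact H
  | app h es i C ih => exact ih.app es i

theorem Ctx.fill_subst (σ : V → Exp S V) (C : Ctx S V) (e : Exp S V) :
    (C.fill e).subst σ = (C.subst σ).fill (e.subst σ) := by
  induction C with
  | hole => rfl
  | app h es i C ih =>
    simp only [Ctx.fill, Ctx.subst, Exp.subst, ← ih]
    congr 1
    funext j
    by_cases hj : j = i
    · subst hj; simp
    · simp [hj]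

theorem RwStep.subst {P : Set (Rule S V)} {a b : Exp S V} (H : RwStep P a b) (σ : V → Exp S V) :
    RwStep P (a.subst σ) (b.subst σ) := by
  cases H with
  | mk C R hR τ hτ =>
    rw [Ctx.fill_subst, Ctx.fill_subst, Exp.subst_subst, Exp.subst_subst]
    exact (RwStep.root hR _).fill _

theorem RwSteps.subst {P : Set (Rule S V)} {a b : Exp S V} (H : RwSteps P a b)
    (σ : V → Exp S V) : RwSteps P (a.subst σ) (b.subst σ) :=
  Relation.ReflTransGen.lift (p := RwStep P) (fun e : Exp S V => e.subst σ)
    (fun _ _ h => RwStep.subst h σ) _ _ H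

/-- Rewriting is compatible with the simultaneous rewriting of arguments. -/
theorem RwSteps.app {P : Set (Rule S V)} {h : S.Sym} {es es' : Fin (S.arity h) → Exp S V}
    (H : ∀ i, RwSteps P (es i) (es' i)) : RwSteps P (.app h es) (.app h es') := by
  classical
  -- `s` is the set of argument positions that are already rewritten.
  have key : ∀ s : Finset (Fin (S.arity h)),
      RwSteps P (.app h es) (.app h fun i => if i ∈ s then es' i else es i) := by
    intro s
    induction s using Finset.induction_on with
    | empty => simp only [Finset.notMem_empty, if_false]; exact .refl
    | insert a s ha ih =>
      refine ih.trans ?_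
      have h1 : (fun i => if i ∈ s then es' i else es i) =
          Function.update (fun i => if i ∈ s then es' i else es i) a (es a) := by
        funext j; by_cases hj : j = a
        · subst hj; simp [ha]
        · simp [hj]
      have h2 : (fun i => if i ∈ insert a s then es' i else es i) =
          Function.update (fun i => if i ∈ s then es' i else es i) a (es' a) := by
        funext j; by_cases hj : j = a
        · subst hj; simp
        · simp [hj]
      rw [h1, h2]
      exact Relation.ReflTransGen.lift (p := RwStep P)
        (fun x => Exp.app h (Function.update (fun i => if i ∈ s then es' i else es i) a x))
        (fun _ _ hs => RwStep.app _ a hs) _ _ (H a)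
  simpa using key Finset.univ

/-- Soundness of narrowing. -/
theorem NarrSteps.rwSteps {P : Set (Rule S V)} {e t : Exp S V} {θ : V → Exp S V}
    (H : NarrSteps P e θ t) : RwSteps P (e.subst θ) t := by
  induction H with
  | refl e => rw [Exp.subst_var]; exact .refl
  | @head e e₁ e' θ₁ θ₂ h₁ _ ih =>
    have : RwStep P (e.subst θ₁) e₁ := by
      cases h₁ with
      | mk C R R' hR hvar ts _ _ hθ =>
        -- Only the unifier property is needed, not its generality.
        rw [Ctx.fill_subst, hθ.2.1]
        exact (RwStep.root_variant hR hvar _).fill _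
    have := this.subst θ₂
    rw [Exp.subst_subst] at this
    exact .head this ih

/-! ### The CRWL calculus -/

section CRWL

variable {P : Set (Rule S V)}

theorem CRWL.isCTerm {e t : Exp S.withBot V} (h : CRWL P e t) : t.IsCTerm := by
  induction h with
  | B e => exact Exp.isCTerm_bot
  | RR x => exact .var x
  | DC c es ts _ ih => exact .con (S := S.withBot) c ts ih
  | OR => assumption

theorem mem_den {e t : Exp S.withBot V} : t ∈ den P e ↔ CRWL P e t :=
  ⟨fun h => h.2, fun h => ⟨h.isCTerm, h⟩⟩

theorem CRWL.mono {e e' t : Exp S.withBot V} (h : CRWL P e t) (he : Exp.Approx e e') :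
    CRWL P e' t := by
  induction h generalizing e' with
  | B e => exact .B _
  | RR x => cases he with | var => exact .RR x
  | DC c es ts _ ih =>
    cases he with
    -- The undefined value is itself a constructor application, with symbol `none` and no arguments,
    -- so it also occurs on the left of `DC`.
    | bot =>
      rw [Exp.app_none_eq_bot]
      exact .B _
    | app _ _ es' H => exact .DC c es' ts fun i => ih i (H i)
  | OR R hR θ hθ es t hargs hrhs ih ih' =>
    cases he with
    | app _ _ es' H => exact .OR R hR θ hθ es' t (fun i => ih i (H i)) hrhs

theorem CRWL.approx_of_isCTerm {e t : Exp S.withBot V} (h : CRWL P e t) (he : e.IsCTerm) :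
    Exp.Approx t e := by
  induction h with
  | B e => exact .bot _
  | RR x => exact .var x
  | DC c es ts _ ih => exact .app _ _ _ fun i => ih i (Exp.isCTerm_con_iff.1 he i)
  | OR => exact (Exp.not_isCTerm_fun he).elim

theorem CRWL.refl_of_isCTerm {t : Exp S.withBot V} (ht : t.IsCTerm) : CRWL P t t := by
  induction ht with
  | var x => exact .RR x
  | con c ts _ ih => exact .DC c ts ts ih

theorem CRWL.subst_of_isCTerm {p : Exp S V} (hp : p.IsCTerm) {σ τ : V → Exp S.withBot V}
    (h : ∀ x ∈ p.vars, CRWL P (σ x) (τ x)) :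
    CRWL P (p.toPartial.subst σ) (p.toPartial.subst τ) := by
  induction hp with
  | var x => exact h x (Exp.mem_vars_var.2 rfl)
  | con c ts _ ih =>
    exact .DC (some c) _ _ fun i => ih i fun x hx => h x (Exp.mem_vars_app.2 ⟨i, hx⟩)

theorem directedOn_exists_upper {α ι : Type*} [Finite ι] {r : α → α → Prop}
    (htrans : ∀ {a b c}, r a b → r b c → r a c) {s : Set α} (hs : DirectedOn r s)
    (hne : s.Nonempty) (f : ι → α) (hf : ∀ i, f i ∈ s) : ∃ z ∈ s, ∀ i, r (f i) z := by
  classical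
  have := Fintype.ofFinite ι
  have key : ∀ T : Finset ι, ∃ z ∈ s, ∀ i ∈ T, r (f i) z := by
    intro T
    induction T using Finset.induction_on with
    | empty => obtain ⟨z, hz⟩ := hne; exact ⟨z, hz, by simp⟩
    | insert a T _ ih =>
      obtain ⟨z, hz, h⟩ := ih
      obtain ⟨w, hw, h1, h2⟩ := hs (f a) (hf a) z hz
      refine ⟨w, hw, fun i hi => ?_⟩
      rcases Finset.mem_insert.1 hi with rfl | hi
      · exact h1
      · exact htrans (h i hi) h2
  obtain ⟨z, hz, h⟩ := key Finset.univ
  exact ⟨z, hz, fun i => h i (Finset.mem_univ i)⟩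

/-- For deterministic programs, the value of an instance of an expression only depends on one value
for each of its variables. -/
theorem CRWLDeterministic.exists_values (hP : CRWLDeterministic P) (σ : V → Exp S.withBot V)
    (e : Exp S.withBot V) {t : Exp S.withBot V} (h : CRWL P (e.subst σ) t) :
    ∃ τ : V → Exp S.withBot V, (∀ x, CRWL P (σ x) (τ x)) ∧ CRWL P (e.subst τ) t := by
  classical
  induction e generalizing t with
  | var x =>
    -- The value `t` for the variable itself; no other variable is needed.
    refine ⟨fun y => if y = x then t else Exp.bot, fun y => ?_, ?_⟩
    · by_cases hy : y = x
      · subst hy; simp only [if_true]; exact h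
      · simpa [hy] using CRWL.B _
    · simpa [Exp.subst] using CRWL.refl_of_isCTerm h.isCTerm
  | app f es ih =>
    -- Each argument brings its own choice of values. Directedness bounds these finitely many values
    -- of a variable by a single one, and raising the valuation keeps every derivation.
    have upper : ∀ ts : Fin (S.withBot.arity f) → Exp S.withBot V,
        (∀ i, CRWL P ((es i).subst σ) (ts i)) → ∃ τ : V → Exp S.withBot V,
          (∀ x, CRWL P (σ x) (τ x)) ∧ ∀ i, CRWL P ((es i).subst τ) (ts i) := by
      intro ts hts
      choose τ hτ hτ' using fun i => ih i (hts i)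
      have : ∀ x, ∃ z ∈ den P (σ x), ∀ i, Exp.Approx (τ i x) z := fun x =>
        directedOn_exists_upper (r := Exp.Approx) Exp.Approx.trans (hP (σ x)) ⟨Exp.bot, mem_den.2 (.B _)⟩
          (fun i => τ i x) fun i => mem_den.2 (hτ i x)
      choose z hz hz' using this
      exact ⟨z, fun x => mem_den.1 (hz x), fun i =>
        (hτ' i).mono (Exp.Approx.subst _ fun x _ => hz' x i)⟩
    simp only [Exp.subst] at h
    cases h with
    | B => exact ⟨fun _ => Exp.bot, fun _ => .B _, .B _⟩
    | DC c _ ts hts =>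
      obtain ⟨τ, h1, h2⟩ := upper ts hts
      exact ⟨τ, h1, .DC c _ _ h2⟩
    | OR R hR θ hθ _ _ hargs hrhs =>
      obtain ⟨τ, h1, h2⟩ := upper _ hargs
      exact ⟨τ, h1, .OR R hR θ hθ _ _ h2 hrhs⟩

/-- `σ` may put reducible expressions for the variables. Determinism supplies a single partial value
`τ x` of each `σ x` that suffices for the right-hand side; the patterns are c-terms, so their
`σ`-instances evaluate to their `τ`-instances, and `τ` can serve as the parameter of `OR`. -/
theorem CRWLDeterministic.crwl_root (hP : CRWLDeterministic P) {R : Rule S V} (hR : R ∈ P)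
    (hR' : R.IsProgramRule) (σ : V → Exp S V) {t : Exp S.withBot V}
    (h : CRWL P (R.rhs.subst σ).toPartial t) : CRWL P (R.lhs.subst σ).toPartial t := by
  classical
  rw [Exp.toPartial_subst] at h
  obtain ⟨τ, hτ, h⟩ := hP.exists_values _ _ h
  have hmem {x : V} (hx : x ∈ R.vars) : restrictSubst (S := S.withBot) R.vars τ x = τ x :=
    restrictSubst_of_mem hx
  refine .OR R hR (restrictSubst (S := S.withBot) R.vars τ)
    (isCSubst_restrictSubst (S := S.withBot) R.finite_vars fun x _ => (hτ x).isCTerm) _ _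
    (fun i => ?_) ?_
  · change CRWL P ((R.args i).subst σ).toPartial _
    rw [Exp.toPartial_subst]
    refine CRWL.subst_of_isCTerm (hR'.1 i) fun x hx => ?_
    rw [hmem (Set.mem_union_left _ (Exp.mem_vars_app.2 ⟨i, hx⟩))]
    exact hτ x
  · rwa [Exp.subst_congr (τ := τ)]
    intro x hx
    rw [Exp.vars_toPartial] at hx
    exact hmem (Set.mem_union_right _ hx)

/-- CRWL sees the arguments of a symbol only through their values, so the claim passes from the
redex to any context. -/
theorem CRWLDeterministic.crwl_of_rwStep (hP : CRWLDeterministic P) (hP' : IsProgram P)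
    {e e' : Exp S V} (H : RwStep P e e') {t : Exp S.withBot V} (h : CRWL P e'.toPartial t) :
    CRWL P e.toPartial t := by
  cases H with
  | mk C R hR σ _ =>
    induction C generalizing t with
    | hole => exact hP.crwl_root hR (hP' R hR) σ h
    | app f es i C ih =>
      have hargs : ∀ (v : Fin (S.arity f) → Exp S.withBot V),
          (∀ j, CRWL P (Function.update es i (C.fill (R.rhs.subst σ)) j).toPartial (v j)) →
          ∀ j, CRWL P (Function.update es i (C.fill (R.lhs.subst σ)) j).toPartial (v j) := by
        intro v hv j
        have := hv j
        by_cases hj : j = i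
        · subst hj
          simp only [Function.update_self] at this ⊢
          exact ih this
        · simpa [hj] using this
      rcases f with c | f
      · simp only [Ctx.fill, Exp.toPartial] at h ⊢
        cases h with
        | B => exact .B _
        | DC _ _ ts hts => exact .DC _ _ _ (hargs ts hts)
      · simp only [Ctx.fill, Exp.toPartial] at h ⊢
        cases h with
        | B => exact .B _
        | OR R' hR' θ hθ _ _ ha hr => exact .OR R' hR' θ hθ _ _ (hargs _ ha) hr

/-- For deterministic programs, CRWL derives every c-term that is reached by rewriting. -/
theorem CRWLDeterministic.crwl_of_rwSteps (hP : CRWLDeterministic P) (hP' : IsProgram P)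
    {e t : Exp S V} (ht : t.IsCTerm) (H : RwSteps P e t) : CRWL P e.toPartial t.toPartial := by
  induction H using Relation.ReflTransGen.head_induction_on with
  | refl => exact .refl_of_isCTerm ht.toPartial
  | head h _ ih => exact hP.crwl_of_rwStep hP' h ih

end CRWL

/-! ### Let-expressions -/

/-- The valuation of the variables seen from below one more let. -/
def consEnv (u : A) (δ : V ⊕ Fin n → A) : V ⊕ Fin (n + 1) → A :=
  Sum.elim (fun x => δ (.inl x)) (Fin.cases u fun i => δ (.inr i))

@[simp]
theorem consEnv_shift (u : A) (δ : V ⊕ Fin n → A) (x : V ⊕ Fin n) :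
    consEnv u δ (shift x) = δ x := by
  rcases x with x | i <;> rfl

theorem consEnv_elim (u : A) (φ : V → A) (δ : Fin n → A) :
    consEnv u (Sum.elim φ δ) = Sum.elim φ (Fin.cases u δ : Fin (n + 1) → A) := by
  funext x
  rcases x with x | i
  · rfl
  · refine Fin.cases ?_ (fun i => ?_) i <;> rfl

theorem Exp.map_shift_subst (u : Exp S Y) (δ : V ⊕ Fin n → Exp S Y) (s : Exp S (V ⊕ Fin n)) :
    (s.map shift).subst (consEnv u δ) = s.subst δ := by
  rw [Exp.map_subst]
  simp only [consEnv_shift]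

theorem liftSubst_subst (σ : V ⊕ Fin m → Exp S (V ⊕ Fin n)) (u : Exp S Y)
    (δ : V ⊕ Fin n → Exp S Y) :
    (fun x => (liftSubst σ x).subst (consEnv u δ)) = consEnv u fun x => (σ x).subst δ := by
  funext x
  rcases x with x | i
  · exact Exp.map_shift_subst u δ _
  · refine Fin.cases rfl (fun i => ?_) i
    exact Exp.map_shift_subst u δ _

namespace LExp

theorem bind_toLExp (σ : V ⊕ Fin m → Exp S (V ⊕ Fin n)) (s : Exp S (V ⊕ Fin m)) :
    s.toLExp.bind σ = (s.subst σ).toLExp := by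
  induction s with
  | var x => rfl
  | app h es ih => exact congrArg (LExp.app h) (funext ih)

theorem mem_FV_app {h : S.Sym} {es : Fin (S.arity h) → LExp S V n} {x : V} :
    x ∈ (LExp.app h es).FV ↔ ∃ i, x ∈ (es i).FV := by
  simp [FV]

theorem mem_FV_toLExp {s : Exp S (V ⊕ Fin n)} {x : V} :
    x ∈ s.toLExp.FV ↔ .inl x ∈ s.vars := by
  induction s with
  | var y => rcases y with y | i <;> simp [Exp.toLExp, FV, Exp.mem_vars_var]
  | app h es ih =>
    simp only [Exp.toLExp, mem_FV_app, Exp.mem_vars_app]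
    exact exists_congr ih

theorem finite_FV (e : LExp S V n) : e.FV.Finite := by
  induction e with
  | var x => rcases x with x | i <;> simp [FV]
  | app h es ih => exact Set.finite_iUnion ih
  | letIn a b iha ihb => exact iha.union ihb

/-- Replaces all lets by substitutions, under a valuation of the visible variables. -/
def unfold {n : ℕ} (e : LExp S V n) (δ : V ⊕ Fin n → Exp S Y) : Exp S Y :=
  match e with
  | .var x => δ x
  | .app h es => .app h fun i => (es i).unfold δ
  | .letIn a b => b.unfold (consEnv (a.unfold δ) δ)

theorem unfold_toLExp (s : Exp S (V ⊕ Fin n)) (δ : V ⊕ Fin n → Exp S Y) :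
    s.toLExp.unfold δ = s.subst δ := by
  induction s with
  | var x => rfl
  | app h es ih => exact congrArg (Exp.app h) (funext ih)

theorem unfold_bind (e : LExp S V m) (σ : V ⊕ Fin m → Exp S (V ⊕ Fin n))
    (δ : V ⊕ Fin n → Exp S Y) : (e.bind σ).unfold δ = e.unfold fun x => (σ x).subst δ := by
  induction e generalizing n with
  | var x => exact unfold_toLExp _ _
  | app h es ih => exact congrArg (Exp.app h) (funext fun i => ih i σ δ)
  | letIn a b iha ihb =>
    simp only [bind, unfold, iha, ihb, liftSubst_subst]

theorem unfold_congr (e : LExp S V n) {δ δ' : V ⊕ Fin n → Exp S Y}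
    (hf : ∀ x ∈ e.FV, δ (.inl x) = δ' (.inl x)) (hb : ∀ i, δ (.inr i) = δ' (.inr i)) :
    e.unfold δ = e.unfold δ' := by
  induction e with
  | var x =>
    rcases x with x | i
    · exact hf x (by simp [FV])
    · exact hb i
  | app h es ih =>
    exact congrArg (Exp.app h) (funext fun i => ih i (fun x hx => hf x (mem_FV_app.2 ⟨i, hx⟩)) hb)
  | letIn a b iha ihb =>
    simp only [unfold]
    rw [iha (fun x hx => hf x (Set.mem_union_left _ hx)) hb]
    refine ihb (fun x hx => hf x (Set.mem_union_right _ hx)) fun i => ?_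
    exact Fin.cases rfl hb i

theorem unfold_subst (e : LExp S V n) (θ : V → Exp S V) (δ : V ⊕ Fin n → Exp S Y) :
    (e.subst θ).unfold δ =
      e.unfold (Sum.elim (fun x => (θ x).subst fun y => δ (.inl y)) fun i => δ (.inr i)) := by
  rw [subst, unfold_bind]
  congr 1
  funext x
  rcases x with x | i
  · exact Exp.map_subst _ _ _
  · rfl

theorem subst_unfold (e : LExp S V n) (δ : V ⊕ Fin n → Exp S Y) (τ : Y → Exp S Z) :
    (e.unfold δ).subst τ = e.unfold fun x => (δ x).subst τ := by
  induction e with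
  | var x => rfl
  | app h es ih => exact congrArg (Exp.app h) (funext fun i => ih i δ)
  | letIn a b iha ihb =>
    simp only [unfold, ihb, ← iha]
    congr 1
    funext x
    rcases x with x | i
    · rfl
    · exact Fin.cases rfl (fun i => rfl) i

theorem unfold_rwSteps {P : Set (Rule S Y)} (e : LExp S V n) {δ δ' : V ⊕ Fin n → Exp S Y}
    (h : ∀ x, RwSteps P (δ x) (δ' x)) : RwSteps P (e.unfold δ) (e.unfold δ') := by
  induction e with
  | var x => exact h x
  | app f es ih => exact RwSteps.app fun i => ih i h
  | letIn a b iha ihb =>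
    refine ihb fun x => ?_
    rcases x with x | i
    · exact h _
    · exact Fin.cases (iha h) (fun i => h _) i

end LExp

theorem LCtx.FV_subset_fill (C : LCtx S V m n) (a : LExp S V m) : a.FV ⊆ (C.fill a).FV := by
  induction C with
  | hole => exact subset_rfl
  | app h es i C ih =>
    intro x hx
    refine LExp.mem_FV_app.2 ⟨i, ?_⟩
    rw [Function.update_self]
    exact ih hx
  | letDef C b ih => exact fun x hx => Set.mem_union_left _ (ih hx)
  | letBody a' C ih => exact fun x hx => Set.mem_union_right _ (ih hx)

theorem LCtx.unfold_fill_congr (C : LCtx S V m n) {a b : LExp S V m}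
    (h : ∀ δ : V ⊕ Fin m → Exp S Y, a.unfold δ = b.unfold δ) (δ : V ⊕ Fin n → Exp S Y) :
    (C.fill a).unfold δ = (C.fill b).unfold δ := by
  induction C with
  | hole => exact h δ
  | app f es i C ih =>
    refine congrArg (Exp.app f) (funext fun j => ?_)
    by_cases hj : j = i
    · subst hj; simpa using ih δ
    · simp [hj]
  | letDef C b ih => simp only [LCtx.fill, LExp.unfold, ih]
  | letBody a C ih => exact ih _

/-- Peeling only changes what is shared, and unfolding forgets sharing. -/
theorem PeelStep.unfold_eq {a b : LExp S V n} (h : PeelStep a b) (δ : V ⊕ Fin n → Exp S Y) :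
    a.unfold δ = b.unfold δ := by
  cases h with
  | letIn h es i hi =>
    refine congrArg (Exp.app h) (funext fun j => ?_)
    by_cases hj : j = i
    · subst hj
      simp [LExp.unfold, consEnv]
    · simp [hj, LExp.weaken, LExp.unfold_bind, Exp.subst]
  | bind t ht e =>
    rw [LExp.unfold, LExp.inst, LExp.unfold_bind, LExp.unfold_toLExp]
    congr 1
    funext x
    rcases x with x | i
    · rfl
    · exact Fin.cases rfl (fun i => rfl) i
  | elim e₁ e₂ => simp [LExp.unfold, LExp.weaken, LExp.unfold_bind, Exp.subst]
  | flat e₁ e₂ e₃ =>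
    simp [LExp.unfold, LExp.weakenUnder, LExp.unfold_bind, liftSubst_subst, Exp.subst]

/-! ### Soundness of let-narrowing -/

/-- If the hole lies in the definition of a let, unfolding copies it once for each use of the bound
variable, possibly never. Hence many steps or none, and the hypothesis for all values `δ` of the
variables bound around the hole. -/
theorem LCtx.unfold_fill_rwSteps {P : Set (Rule S V)} {θ : V → Exp S V} (C : LCtx S V m n)
    {a b : LExp S V m}
    (h : ∀ δ : Fin m → Exp S V,
      RwSteps P (a.unfold (Sum.elim θ δ)) (b.unfold (Sum.elim Exp.var δ)))
    (δ : Fin n → Exp S V) :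
    RwSteps P ((C.fill a).unfold (Sum.elim θ δ))
      (((C.subst θ).fill b).unfold (Sum.elim Exp.var δ)) := by
  have hsub : ∀ {k : ℕ} (e : LExp S V k) (δ : Fin k → Exp S V),
      (e.subst θ).unfold (Sum.elim Exp.var δ) = e.unfold (Sum.elim θ δ) := by
    intro k e δ
    rw [LExp.unfold_subst]
    simp only [Sum.elim_inl, Sum.elim_inr, Exp.subst_var]
  induction C with
  | hole => exact h δ
  | app f es i C ih =>
    refine RwSteps.app fun j => ?_
    by_cases hj : j = i
    · subst hj; simpa using ih δ
    · simp only [hj, ne_eq, not_false_eq_true, Function.update_of_ne, hsub]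
      exact .refl
  | letDef C b ih =>
    simp only [LCtx.fill, LCtx.subst, LExp.unfold, consEnv_elim, hsub]
    refine LExp.unfold_rwSteps b fun x => ?_
    rcases x with x | i
    · exact .refl
    · exact Fin.cases (ih δ) (fun _ => .refl) i
  | letBody a C ih =>
    simp only [LCtx.fill, LCtx.subst, LExp.unfold, consEnv_elim, hsub]
    exact ih _

theorem Exp.closeWith_subst {ν : Fin m → V} (hν : Function.Injective ν) (φ : V → Exp S Y)
    (δ : Fin m → Exp S Y) (e : Exp S V) :
    (e.closeWith ν).subst (Sum.elim φ δ) = e.subst (Function.extend ν δ φ) := by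
  classical
  rw [Exp.closeWith, Exp.map_subst]
  congr 1
  funext x
  by_cases h : ∃ i, ν i = x
  · have hx := h.choose_spec
    rw [dif_pos h]
    conv_rhs => rw [← hx, hν.extend_apply]
    rfl
  · rw [dif_neg h, Function.extend_apply' _ _ _ h]
    rfl

theorem LetNarrStep.unfold_rwSteps {P : Set (Rule S V)} {e e' : LExp S V 0} {θ : V → Exp S V}
    (h : LetNarrStep P e θ e') :
    RwSteps P (e.unfold (Sum.elim θ Fin.elim0)) (e'.unfold (Sum.elim Exp.var Fin.elim0)) := by
  cases h with
  | peel C a b h =>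
    rw [C.unfold_fill_congr h.unfold_eq]
    exact .refl
  | @narr m C R R' hR hvar ts ν hν hνFV hfresh _ hθ hunif hdom hran =>
    refine C.unfold_fill_rwSteps (fun δ => ?_) _
    -- `φ` replaces the names of the bound variables by their values and fixes all else. The call
    -- then rewrites at the root with matching substitution `θφ`.
    set φ : V → Exp S V := Function.extend ν δ Exp.var with hφ
    have hφν : ∀ i, φ (ν i) = δ i := fun i => hν.extend_apply _ _ _
    have hφ' : ∀ x, x ∉ Set.range ν → φ x = .var x := fun x hx =>
      Function.extend_apply' _ _ _ hx
    have hl : (LExp.app (.inr R'.f) ts).unfold (Sum.elim θ δ) =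
        R'.lhs.subst fun x => (θ x).subst φ := by
      have h1 := congrArg (fun a => a.unfold (Sum.elim φ Fin.elim0)) hunif
      simp only [LExp.openWith, LExp.unfold_subst, LExp.unfold_bind, Exp.inLExp,
        LExp.unfold_toLExp, Exp.map_subst, Exp.subst_subst, Sum.elim_inl] at h1
      rw [← h1]
      refine LExp.unfold_congr _ (fun x hx => ?_) fun i => ?_
      · have hxC := C.FV_subset_fill _ hx
        refine (Exp.subst_eq_self _ fun y hy => hφ' y fun hyν => ?_).symm
        by_cases hxd : x ∈ substDom θ
        · refine Set.disjoint_left.1 (hran x hxd fun hxl => ?_) hy hyν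
          -- A variable of the narrowed expression is not in the fresh left-hand side, so the range
          -- condition keeps its image free of bound names.
          exact Set.disjoint_left.1 hfresh (Set.mem_union_left _ hxl) (Set.mem_union_left _ hxC)
        · rw [Sum.elim_inl, not_not.1 hxd, Exp.mem_vars_var] at hy
          subst hy
          exact Set.disjoint_left.1 hνFV hyν hxC
      · have : θ (ν i) = .var (ν i) :=
          not_not.1 fun h => Set.disjoint_left.1 hdom h ⟨i, rfl⟩
        simp only [Sum.elim_inr, Exp.subst, Sum.elim_inl, this, hφν]
    rw [hl, LExp.unfold_toLExp, Exp.closeWith_subst hν, Exp.subst_subst]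
    exact .single (RwStep.root_variant hR hvar _)

/-- Soundness of let-narrowing. -/
theorem LetNarrSteps.unfold_rwSteps {P : Set (Rule S V)} {e e' : LExp S V 0} {θ : V → Exp S V}
    (h : LetNarrSteps P e θ e') :
    RwSteps P (e.unfold (Sum.elim θ Fin.elim0)) (e'.unfold (Sum.elim Exp.var Fin.elim0)) := by
  induction h with
  | refl e => exact .refl
  | @head e e₁ e' θ₁ θ₂ h₁ _ ih =>
    have h := h₁.unfold_rwSteps.subst θ₂
    simp only [LExp.subst_unfold] at h
    have hcomp : ∀ σ : V → Exp S V, (fun x => (Sum.elim σ Fin.elim0 x : Exp S V).subst θ₂) =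
        Sum.elim (substComp σ θ₂) (Fin.elim0 : Fin 0 → Exp S V) := by
      intro σ
      funext x
      rcases x with x | i
      · rfl
      · exact i.elim0
    rw [hcomp, hcomp] at h
    exact h.trans ih

theorem LetNarrSteps.rwSteps {P : Set (Rule S V)} {e t : Exp S V} {θ : V → Exp S V}
    (h : LetNarrSteps P e.inLExp θ t.inLExp) : RwSteps P (e.subst θ) t := by
  have := h.unfold_rwSteps
  simpa only [Exp.inLExp, LExp.unfold_toLExp, Exp.map_subst, Sum.elim_inl, Exp.subst_var]
    using this

/-! ### Peeling in contexts -/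

/-- A step by one of the rules LetIn, Bind, Elim, Flat in an arbitrary context. -/
def PeelIn (a b : LExp S V n) : Prop :=
  ∃ (m : ℕ) (C : LCtx S V m n) (a' b' : LExp S V m),
    PeelStep a' b' ∧ a = C.fill a' ∧ b = C.fill b'

theorem PeelStep.peelIn {a b : LExp S V n} (h : PeelStep a b) : PeelIn a b :=
  ⟨n, .hole, a, b, h, rfl, rfl⟩

theorem PeelIn.app {h : S.Sym} {es : Fin (S.arity h) → LExp S V n} {i : Fin (S.arity h)}
    {b : LExp S V n} (H : PeelIn (es i) b) :
    PeelIn (.app h es) (.app h (Function.update es i b)) := by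
  obtain ⟨m, C, a', b', h', ha, rfl⟩ := H
  refine ⟨m, .app h es i C, a', b', h', ?_, rfl⟩
  rw [LCtx.fill, ← ha, Function.update_eq_self]

theorem PeelIn.letDef {a a' : LExp S V n} (H : PeelIn a a') (b : LExp S V (n + 1)) :
    PeelIn (.letIn a b) (.letIn a' b) := by
  obtain ⟨m, C, c, d, h', rfl, rfl⟩ := H
  exact ⟨m, .letDef C b, c, d, h', rfl, rfl⟩

theorem PeelIn.letBody (a : LExp S V n) {b b' : LExp S V (n + 1)} (H : PeelIn b b') :
    PeelIn (.letIn a b) (.letIn a b') := by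
  obtain ⟨m, C, c, d, h', rfl, rfl⟩ := H
  exact ⟨m, .letBody a C, c, d, h', rfl, rfl⟩

theorem PeelIn.letNarrStep {P : Set (Rule S V)} {a b : LExp S V 0} (h : PeelIn a b) :
    LetNarrStep P a Exp.var b := by
  obtain ⟨m, C, a', b', h', rfl, rfl⟩ := h
  exact .peel C a' b' h'

/-! ### Termination and normal forms of peeling -/

namespace LExp

/-- A weight that is decreased by peeling. -/
def weight {n : ℕ} : LExp S V n → ℕ
  | .var _ => 0
  | .app (.inl _) es => 4 * ∑ i, (es i).weight
  | .app (.inr _) es => 1 + 4 * ∑ i, (es i).weight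
  | .letIn a b => 2 * a.weight + b.weight + 1

theorem weight_toLExp {s : Exp S (V ⊕ Fin n)} (hs : s.IsCTerm) : s.toLExp.weight = 0 := by
  induction hs with
  | var x => rfl
  | con c ts _ ih =>
    rw [Exp.toLExp, weight, Finset.sum_eq_zero fun i _ => ih i, mul_zero]

theorem liftSubst_isCTerm {σ : V ⊕ Fin m → Exp S (V ⊕ Fin n)} (hσ : ∀ x, (σ x).IsCTerm)
    (x : V ⊕ Fin (m + 1)) : (liftSubst σ x).IsCTerm := by
  rcases x with x | i
  · exact (hσ _).map
  · exact Fin.cases (.var _) (fun i => (hσ (.inr i)).map) i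

theorem weight_bind (e : LExp S V m) {σ : V ⊕ Fin m → Exp S (V ⊕ Fin n)}
    (hσ : ∀ x, (σ x).IsCTerm) : (e.bind σ).weight = e.weight := by
  induction e generalizing n with
  | var x => exact weight_toLExp (hσ x)
  | app h es ih =>
    have := Finset.sum_congr rfl fun i (_ : i ∈ Finset.univ) => ih i hσ
    rcases h with c | f
    · exact congrArg (4 * ·) this
    · exact congrArg (1 + 4 * ·) this
  | letIn a b iha ihb => simp [bind, weight, iha hσ, ihb (liftSubst_isCTerm hσ)]

theorem IsSuspendable.weight_pos {e : LExp S V n} (h : e.IsSuspendable) : 0 < e.weight := by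
  rcases e with x | ⟨c | f, es⟩ | ⟨a, b⟩
  · exact h.elim
  · exact h.elim
  · simp [weight]
  · simp [weight]

theorem weight_app_lt {h : S.Sym} {es es' : Fin (S.arity h) → LExp S V n}
    (H : ∑ i, (es i).weight < ∑ i, (es' i).weight) :
    (LExp.app h es).weight < (LExp.app h es').weight := by
  rcases h with c | f <;> simp only [weight] <;> omega

end LExp

/-- Bind may copy its c-term, which is harmless as c-terms weigh nothing. The factor 2 on
definitions makes Flat decrease; the factor 4 on arguments pays for LetIn, because a suspendable
argument has positive weight. -/
theorem PeelStep.weight_lt {a b : LExp S V n} (h : PeelStep a b) : b.weight < a.weight := by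
  have hw : ∀ {k : ℕ} (e : LExp S V k), e.weaken.weight = e.weight := fun e =>
    e.weight_bind fun _ => .var _
  cases h with
  | letIn h es i hi =>
    have hpos := hi.weight_pos
    have hsum : ∑ j, (Function.update (fun j => (es j).weaken) i (.var (.inr 0)) j).weight +
        (es i).weight = ∑ j, (es j).weight := by
      rw [← Finset.add_sum_erase _ _ (Finset.mem_univ i),
        ← Finset.add_sum_erase _ (fun j => (es j).weight) (Finset.mem_univ i),
        Finset.sum_congr rfl (g := fun j => (es j).weight)]
      · simp [LExp.weight, add_comm]
      · intro j hj
        simp [Finset.ne_of_mem_erase hj, hw]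
    rcases h with c | f <;> simp only [LExp.weight] <;> omega
  | bind t ht e =>
    rw [LExp.inst, LExp.weight_bind, LExp.weight]
    · omega
    · rintro (x | i)
      · exact .var _
      · exact Fin.cases ht (fun _ => .var _) i
  | elim e₁ e₂ =>
    rw [LExp.weight, hw]
    omega
  | flat e₁ e₂ e₃ =>
    have : e₃.weakenUnder.weight = e₃.weight :=
      e₃.weight_bind (LExp.liftSubst_isCTerm fun _ => .var _)
    simp only [LExp.weight, this]
    omega

theorem PeelIn.weight_lt {a b : LExp S V n} (h : PeelIn a b) : b.weight < a.weight := by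
  obtain ⟨m, C, a', b', h', rfl, rfl⟩ := h
  induction C with
  | hole => exact h'.weight_lt
  | app h es i C ih =>
    refine LExp.weight_app_lt ?_
    refine Finset.sum_lt_sum (fun j _ => ?_) ⟨i, Finset.mem_univ i, by simpa using ih⟩
    by_cases hj : j = i
    · subst hj; simpa using ih.le
    · simp [hj]
  | letDef C b ih => simp only [LCtx.fill, LExp.weight]; omega
  | letBody a C ih => simp only [LCtx.fill, LExp.weight]; omega

/-- Peel-normal forms: a list of bindings of flat calls, followed by a c-term or a flat call. -/
inductive PeelNF : {n : ℕ} → LExp S V n → Prop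
  | cterm {n : ℕ} (s : Exp S (V ⊕ Fin n)) (hs : s.IsCTerm) : PeelNF s.toLExp
  | call {n : ℕ} (f : S.Fun) (ts : Fin (S.arity (.inr f)) → Exp S (V ⊕ Fin n))
      (hts : ∀ i, (ts i).IsCTerm) : PeelNF (.app (.inr f) fun i => (ts i).toLExp)
  | letCall {n : ℕ} (f : S.Fun) (ts : Fin (S.arity (.inr f)) → Exp S (V ⊕ Fin n))
      (hts : ∀ i, (ts i).IsCTerm) (b : LExp S V (n + 1)) (hb : PeelNF b) :
      PeelNF (.letIn (.app (.inr f) fun i => (ts i).toLExp) b)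

theorem PeelNF.exists_cterm {e : LExp S V n} (h : PeelNF e) (hs : ¬ e.IsSuspendable) :
    ∃ s : Exp S (V ⊕ Fin n), s.IsCTerm ∧ e = s.toLExp := by
  cases h with
  | cterm s h => exact ⟨s, h, rfl⟩
  | call => exact (hs trivial).elim
  | letCall => exact (hs trivial).elim

/-- An application without suspendable or peelable arguments has only c-terms as arguments. A let
with normal definition is handled by Bind or Flat unless the definition is a flat call; then the
body decides. -/
theorem PeelNF.or_peelIn (e : LExp S V n) : PeelNF e ∨ ∃ e', PeelIn e e' := by
  induction e with
  | var x => exact .inl (.cterm (.var x) (.var x))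
  | app h es ih =>
    by_cases hsus : ∃ i, (es i).IsSuspendable
    · obtain ⟨i, hi⟩ := hsus
      exact .inr ⟨_, (PeelStep.letIn h es i hi).peelIn⟩
    by_cases hstep : ∃ i e', PeelIn (es i) e'
    · obtain ⟨i, e', he'⟩ := hstep
      exact .inr ⟨_, he'.app⟩
    simp only [not_exists] at hsus hstep
    have hnf : ∀ i, ∃ s : Exp S (V ⊕ Fin _), s.IsCTerm ∧ es i = s.toLExp := fun i =>
      ((ih i).resolve_right fun ⟨e', he'⟩ => hstep i e' he').exists_cterm (hsus i)
    choose ts hts hes using hnf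
    obtain rfl : es = fun i => (ts i).toLExp := funext hes
    left
    rcases h with c | f
    · exact .cterm (.app (.inl c) ts) (.con c ts hts)
    · exact .call f ts hts
  | letIn a b iha ihb =>
    rcases iha with ha | ⟨a', ha⟩
    · cases ha with
      | cterm s hs => exact .inr ⟨_, (PeelStep.bind s hs b).peelIn⟩
      | call f ts hts =>
        rcases ihb with hb | ⟨b', hb⟩
        · exact .inl (.letCall f ts hts b hb)
        · exact .inr ⟨_, hb.letBody _⟩
      | letCall f ts hts a hb => exact .inr ⟨_, (PeelStep.flat _ a b).peelIn⟩
    · exact .inr ⟨_, ha.letDef b⟩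

/-! ### A call-time choice semantics of let-expressions -/

/-- `LSem P δ e K t`: the partial c-term `t` is a value of `e` under the valuation `δ` of the
visible variables, derivable with at most `K` applications of program rules. -/
inductive LSem (P : Set (Rule S V)) : {n : ℕ} → (V ⊕ Fin n → Exp S.withBot V) → LExp S V n → ℕ →
    Exp S.withBot V → Prop
  | bot {n : ℕ} (δ : V ⊕ Fin n → Exp S.withBot V) (e : LExp S V n) (K : ℕ) : LSem P δ e K Exp.bot
  | var {n : ℕ} {δ : V ⊕ Fin n → Exp S.withBot V} {x : V ⊕ Fin n} (K : ℕ) {t : Exp S.withBot V}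
      (h : Exp.Approx t (δ x)) : LSem P δ (.var x) K t
  | con {n : ℕ} {δ : V ⊕ Fin n → Exp S.withBot V} (c : S.Con)
      {es : Fin (S.arity (.inl c)) → LExp S V n} {k : Fin (S.arity (.inl c)) → ℕ} {K : ℕ}
      {ts : Fin (S.arity (.inl c)) → Exp S.withBot V} (h : ∀ i, LSem P δ (es i) (k i) (ts i))
      (hK : ∑ i, k i ≤ K) : LSem P δ (.app (.inl c) es) K (.app (S := S.withBot) (.inl (some c)) ts)
  | call {n : ℕ} {δ : V ⊕ Fin n → Exp S.withBot V} (R : Rule S V) (hR : R ∈ P)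
      (τ : V → Exp S.withBot V) (hτ : ∀ x, (τ x).IsCTerm)
      {es : Fin (S.arity (.inr R.f)) → LExp S V n} {k : Fin (S.arity (.inr R.f)) → ℕ} {j K : ℕ}
      {t : Exp S.withBot V} (hargs : ∀ i, LSem P δ (es i) (k i) ((R.args i).toPartial.subst τ))
      (hrhs : LSem P (Sum.elim τ Fin.elim0) R.rhs.inLExp j t)
      (hK : ∑ i, k i + j < K) : LSem P δ (.app (.inr R.f) es) K t
  | letIn {n : ℕ} {δ : V ⊕ Fin n → Exp S.withBot V} {a : LExp S V n} {b : LExp S V (n + 1)}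
      {u t : Exp S.withBot V} {k₁ k₂ K : ℕ} (ha : LSem P δ a k₁ u)
      (hb : LSem P (consEnv u δ) b k₂ t) (hK : k₁ + k₂ ≤ K) : LSem P δ (.letIn a b) K t

theorem Exp.toPartial_map_subst (ρ : X → Y) (δ : Y → Exp S.withBot Z) (s : Exp S X) :
    (s.map ρ).toPartial.subst δ = s.toPartial.subst fun x => δ (ρ x) := by
  rw [Exp.map, Exp.toPartial_subst, Exp.subst_subst]
  rfl

namespace LSem

variable {P : Set (Rule S V)} {δ : V ⊕ Fin n → Exp S.withBot V}

theorem mono {e : LExp S V n} {K K' : ℕ} {t : Exp S.withBot V} (h : LSem P δ e K t)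
    (hK : K ≤ K') : LSem P δ e K' t := by
  cases h with
  | bot => exact .bot _ _ _
  | var _ h => exact .var _ h
  | con c h hk => exact .con c h (hk.trans hK)
  | call R hR τ hτ ha hr hk => exact .call R hR τ hτ ha hr (hk.trans_le hK)
  | letIn ha hb hk => exact .letIn ha hb (hk.trans hK)

theorem of_approx {s : Exp S (V ⊕ Fin n)} (hs : s.IsCTerm) {t : Exp S.withBot V}
    (h : Exp.Approx t (s.toPartial.subst δ)) (K : ℕ) : LSem P δ s.toLExp K t := by
  have key : LSem P δ s.toLExp 0 t := by
    induction hs generalizing t with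
    | var x => exact .var _ h
    | con c ts _ ih =>
      rcases Exp.approx_app_iff.1 h with rfl | ⟨ts', rfl, H⟩
      · exact .bot _ _ _
      · exact .con c (k := fun _ => 0) (fun i => ih i (H i)) (by simp)
  exact key.mono (Nat.zero_le K)

theorem approx {s : Exp S (V ⊕ Fin n)} (hs : s.IsCTerm) {t : Exp S.withBot V} {K : ℕ}
    (h : LSem P δ s.toLExp K t) : Exp.Approx t (s.toPartial.subst δ) := by
  induction hs generalizing t K with
  | var x =>
    cases h with
    | bot => exact .bot _
    | var _ h => exact h
  | con c ts _ ih =>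
    cases h with
    | bot => exact .bot _
    | con _ h _ => exact .app _ _ _ fun i => ih i (h i)

/-- c-terms evaluate without rule applications, so replacing variables by c-terms with at least the
same value preserves value and bound. Free variables that do not occur are left unconstrained, since
later substitutions are controlled only on the variables that matter. -/
theorem bind {τ : V ⊕ Fin m → Exp S.withBot V} {σ : V ⊕ Fin m → Exp S (V ⊕ Fin n)}
    {e : LExp S V m} {K : ℕ} {t : Exp S.withBot V} (H : LSem P τ e K t)
    (hf : ∀ x ∈ e.FV, (σ (.inl x)).IsCTerm ∧
      Exp.Approx (τ (.inl x)) ((σ (.inl x)).toPartial.subst δ))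
    (hb : ∀ i, (σ (.inr i)).IsCTerm ∧ Exp.Approx (τ (.inr i)) ((σ (.inr i)).toPartial.subst δ)) :
    LSem P δ (e.bind σ) K t := by
  induction H generalizing n with
  | bot => exact .bot _ _ _
  | @var _ τ x K t h =>
    have hx : (σ x).IsCTerm ∧ Exp.Approx (τ x) ((σ x).toPartial.subst δ) := by
      rcases x with x | i
      · exact hf x (by simp [LExp.FV])
      · exact hb i
    exact of_approx hx.1 (h.trans hx.2) K
  | con c _ hK ih =>
    exact .con c (fun i => ih i (fun x hx => hf x (LExp.mem_FV_app.2 ⟨i, hx⟩)) hb) hK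
  | call R hR τ hτ _ hrhs hK ih =>
    exact .call R hR τ hτ (fun i => ih i (fun x hx => hf x (LExp.mem_FV_app.2 ⟨i, hx⟩)) hb) hrhs hK
  | letIn _ _ hK iha ihb =>
    refine .letIn (iha (fun x hx => hf x (Set.mem_union_left _ hx)) hb)
      (ihb (fun x hx => ?_) fun i => ?_) hK
    · obtain ⟨h1, h2⟩ := hf x (Set.mem_union_right _ hx)
      refine ⟨h1.map, ?_⟩
      change Exp.Approx _ (((σ (.inl x)).map shift).toPartial.subst _)
      rw [Exp.toPartial_map_subst]
      simp only [consEnv_shift]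
      exact h2
    · refine Fin.cases ⟨.var _, .refl _⟩ (fun i => ?_) i
      obtain ⟨h1, h2⟩ := hb i
      refine ⟨h1.map, ?_⟩
      change Exp.Approx _ (((σ (.inr i)).map shift).toPartial.subst _)
      rw [Exp.toPartial_map_subst]
      simp only [consEnv_shift]
      exact h2

/-- The converse holds because a c-term has no values beyond the approximations of its instance. -/
theorem of_bind {τ : V ⊕ Fin m → Exp S.withBot V} {σ : V ⊕ Fin m → Exp S (V ⊕ Fin n)}
    {e : LExp S V m} {K : ℕ} {t : Exp S.withBot V} (H : LSem P δ (e.bind σ) K t)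
    (hσ : ∀ x, (σ x).IsCTerm ∧ Exp.Approx ((σ x).toPartial.subst δ) (τ x)) :
    LSem P τ e K t := by
  induction e generalizing n K t with
  | var x => exact .var _ ((approx (hσ x).1 H).trans (hσ x).2)
  | app h es ih =>
    rcases h with c | f
    · cases H with
      | bot => exact .bot _ _ _
      | con _ h hK => exact .con c (fun i => ih i (h i) hσ) hK
    · cases H with
      | bot => exact .bot _ _ _
      | call R hR τ' hτ hargs hrhs hK => exact .call R hR τ' hτ (fun i => ih i (hargs i) hσ) hrhs hK
  | letIn a b iha ihb =>
    cases H with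
    | bot => exact .bot _ _ _
    | @letIn _ _ _ _ u _ _ _ _ ha hb hK =>
      refine .letIn (iha ha hσ) (ihb hb fun x => ?_) hK
      rcases x with x | i
      · refine ⟨(hσ _).1.map, ?_⟩
        change Exp.Approx (((σ (.inl x)).map shift).toPartial.subst _) _
        rw [Exp.toPartial_map_subst]
        simp only [consEnv_shift]
        exact (hσ (.inl x)).2
      · refine Fin.cases ⟨.var _, .refl _⟩ (fun i => ?_) i
        refine ⟨(hσ _).1.map, ?_⟩
        change Exp.Approx (((σ (.inr i)).map shift).toPartial.subst _) _
        rw [Exp.toPartial_map_subst]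
        simp only [consEnv_shift]
        exact (hσ (.inr i)).2

theorem weaken {e : LExp S V n} {K : ℕ} {t : Exp S.withBot V} (u : Exp S.withBot V)
    (H : LSem P δ e K t) : LSem P (consEnv u δ) e.weaken K t :=
  H.bind (fun _ _ => ⟨.var _, .refl _⟩) fun _ => ⟨.var _, .refl _⟩

end LSem

theorem sum_update_le {ι : Type*} [Fintype ι] [DecidableEq ι] (k : ι → ℕ) (i : ι) :
    k i + ∑ j, Function.update k i 0 j ≤ ∑ j, k j := by
  rw [← Finset.add_sum_erase _ k (Finset.mem_univ i),
    ← Finset.add_sum_erase _ (Function.update k i 0) (Finset.mem_univ i),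
    Finset.sum_congr rfl (g := k)]
  · simp
  · intro j hj
    simp [Finset.ne_of_mem_erase hj]

/-- LetIn moves the derivation for an argument to the new binding and reads its value off the
environment at cost 0, so the total is unchanged. The other rules do not raise it either. -/
theorem PeelStep.lSem {P : Set (Rule S V)} {δ : V ⊕ Fin n → Exp S.withBot V} {a b : LExp S V n}
    (h : PeelStep a b) {K : ℕ} {t : Exp S.withBot V} (H : LSem P δ a K t) : LSem P δ b K t := by
  cases h with
  | letIn h es i hi =>
    have hargs : ∀ (k : Fin (S.arity h) → ℕ) (ts : Fin (S.arity h) → Exp S.withBot V),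
        (∀ j, LSem P δ (es j) (k j) (ts j)) → ∀ j, LSem P (consEnv (ts i) δ)
          (Function.update (fun j => (es j).weaken) i (.var (.inr 0)) j)
          (Function.update k i 0 j) (ts j) := by
      intro k ts hts j
      by_cases hj : j = i
      · subst hj
        simp only [Function.update_self]
        exact .var _ (.refl _)
      · simp only [ne_eq, hj, not_false_eq_true, Function.update_of_ne]
        exact (hts j).weaken _
    rcases h with c | f
    · cases H with
      | bot => exact .bot _ _ _
      | @con _ _ _ _ k _ ts hts hK =>
        exact .letIn (hts i) (.con c (hargs k ts hts) le_rfl) ((sum_update_le k i).trans hK)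
    · cases H with
      | bot => exact .bot _ _ _
      | @call _ _ R hR τ hτ _ k j _ _ ha hr hK =>
        refine .letIn (ha i) (.call R hR τ hτ (hargs k _ ha) hr (Nat.lt_succ_self _)) ?_
        have := sum_update_le k i
        omega
  | bind s hs e =>
    cases H with
    | bot => exact .bot _ _ _
    | letIn ha hb hK =>
      refine LSem.mono ?_ (le_trans (Nat.le_add_left _ _) hK)
      refine LSem.bind hb (fun _ _ => ⟨.var _, .refl _⟩) fun i => ?_
      exact Fin.cases ⟨hs, LSem.approx hs ha⟩ (fun _ => ⟨.var _, .refl _⟩) i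
  | elim e₁ e₂ =>
    cases H with
    | bot => exact .bot _ _ _
    | letIn ha hb hK =>
      refine (LSem.of_bind hb fun x => ⟨.var _, ?_⟩).mono (by omega)
      change Exp.Approx (consEnv _ δ (shift x)) _
      rw [consEnv_shift]
      exact .refl _
  | flat e₁ e₂ e₃ =>
    cases H with
    | bot => exact .bot _ _ _
    | letIn h₁₂ h₃ hK =>
      cases h₁₂ with
      | bot =>
        -- The inner let was left unevaluated as a whole; after Flat both of its parts are.
        refine .letIn (.bot _ _ 0) (.letIn (.bot _ _ 0) (LSem.bind h₃ (fun _ _ => ⟨.var _, .refl _⟩)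
          fun i => ?_) le_rfl) (by omega)
        exact Fin.cases ⟨.var _, .refl _⟩ (fun _ => ⟨.var _, .refl _⟩) i
      | letIn h₁ h₂ hK' =>
        refine .letIn h₁ (.letIn h₂ (LSem.bind h₃ (fun _ _ => ⟨.var _, .refl _⟩)
          fun i => ?_) le_rfl) (by omega)
        exact Fin.cases ⟨.var _, .refl _⟩ (fun _ => ⟨.var _, .refl _⟩) i

theorem PeelIn.lSem {P : Set (Rule S V)} {δ : V ⊕ Fin n → Exp S.withBot V} {a b : LExp S V n}
    (h : PeelIn a b) {K : ℕ} {t : Exp S.withBot V} (H : LSem P δ a K t) : LSem P δ b K t := by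
  obtain ⟨m, C, a', b', h', rfl, rfl⟩ := h
  induction C generalizing K t with
  | hole => exact h'.lSem H
  | app h es i C ih =>
    have hargs : ∀ (k : Fin (S.arity h) → ℕ) (ts : Fin (S.arity h) → Exp S.withBot V),
        (∀ j, LSem P δ (Function.update es i (C.fill a') j) (k j) (ts j)) →
        ∀ j, LSem P δ (Function.update es i (C.fill b') j) (k j) (ts j) := by
      intro k ts hts j
      have := hts j
      by_cases hj : j = i
      · subst hj
        simp only [Function.update_self] at this ⊢
        exact ih this
      · simpa [hj] using this
    rcases h with c | f
    · cases H with
      | bot => exact .bot _ _ _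
      | con _ hts hK => exact .con c (hargs _ _ hts) hK
    · cases H with
      | bot => exact .bot _ _ _
      | call R hR τ hτ ha hr hK => exact .call R hR τ hτ (hargs _ _ ha) hr hK
  | letDef C b ih =>
    cases H with
    | bot => exact .bot _ _ _
    | letIn ha hb hK => exact .letIn (ih ha) hb hK
  | letBody a C ih =>
    cases H with
    | bot => exact .bot _ _ _
    | letIn ha hb hK => exact .letIn ha (ih hb) hK

/-- The environment holds c-terms, whose values are just their approximations, so whatever rule
ended the derivation, no program rule is counted. -/
theorem CRWL.lSem_var {P : Set (Rule S V)} {e t : Exp S.withBot V} (h : CRWL P e t)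
    {δ : V → Exp S.withBot V} (hδ : ∀ x, (δ x).IsCTerm) {x : V}
    (he : e = (Exp.var x : Exp S V).toPartial.subst δ) :
    ∃ K, LSem P (Sum.elim δ Fin.elim0) (Exp.var x : Exp S V).inLExp K t := by
  subst he
  exact ⟨0, .var _ (h.approx_of_isCTerm (hδ x))⟩

theorem CRWL.exists_lSem {P : Set (Rule S V)} {e' t : Exp S.withBot V} (h : CRWL P e' t)
    (e : Exp S V) (δ : V → Exp S.withBot V) (hδ : ∀ x, (δ x).IsCTerm)
    (he : e' = e.toPartial.subst δ) : ∃ K, LSem P (Sum.elim δ Fin.elim0) e.inLExp K t := by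
  induction h generalizing e δ with
  | B => exact ⟨0, .bot _ _ _⟩
  | RR x =>
    rcases e with y | ⟨c | f, es⟩
    · exact CRWL.lSem_var (P := P) (.RR x) hδ he
    · cases he
    · cases he
  | DC c es' ts h ih =>
    rcases e with y | ⟨c | f, es⟩
    · exact CRWL.lSem_var (P := P) (.DC c es' ts h) hδ he
    · cases he
      choose k hk using fun i => ih i (es i) δ hδ rfl
      exact ⟨_, .con c hk le_rfl⟩
    · cases he
  | OR R hR θ hθ es' t hargs hrhs ih ih' =>
    rcases e with y | ⟨c | f, es⟩
    · exact CRWL.lSem_var (P := P) (.OR R hR θ hθ es' t hargs hrhs) hδ he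
    · cases he
    · cases he
      choose k hk using fun i => ih i (es i) δ hδ rfl
      obtain ⟨j, hj⟩ := ih' R.rhs θ hθ.2 rfl
      exact ⟨_, .call R hR θ hθ.2 hk hj (Nat.lt_succ_self _)⟩

/-! ### Finding the call to be narrowed -/

/-- The valuation in which all let-bound variables are undefined. -/
def botEnv (n : ℕ) (θ : V → Exp S V) : V ⊕ Fin n → Exp S.withBot V :=
  Sum.elim (fun x => (θ x).toPartial) fun _ => Exp.bot

theorem consEnv_botEnv (θ : V → Exp S V) : consEnv Exp.bot (botEnv n θ) = botEnv (n + 1) θ := by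
  funext x
  rcases x with x | i
  · rfl
  · exact Fin.cases rfl (fun _ => rfl) i

theorem botEnv_zero (θ : V → Exp S V) :
    botEnv 0 θ = Sum.elim (fun x => (θ x).toPartial) Fin.elim0 := by
  funext x
  rcases x with x | i
  · rfl
  · exact i.elim0

theorem Exp.eq_of_approx_toPartial {a b : Exp S X}
    (h : Exp.Approx a.toPartial b.toPartial) : a = b := by
  induction b generalizing a with
  | var x =>
    rcases approx_var_iff.1 h with h | h
    · exact (toPartial_ne_bot _ h).elim
    · rcases a with y | ⟨c | f, es⟩
      · simp only [toPartial] at h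
        cases h; rfl
      · cases h
      · cases h
  | app g es ih =>
    rcases g with c | f
    · rcases approx_app_iff.1 h with h | ⟨es', h, H⟩
      · exact (toPartial_ne_bot _ h).elim
      · rcases a with y | ⟨c | f, es⟩
        · cases h
        · cases h
          exact congrArg _ (funext fun i => ih i (H i))
        · cases h
    · rcases approx_app_iff.1 h with h | ⟨es', h, H⟩
      · exact (toPartial_ne_bot _ h).elim
      · rcases a with y | ⟨c | f, es⟩
        · cases h
        · cases h
        · cases h
          exact congrArg _ (funext fun i => ih i (H i))

/-- A let-bound variable would contribute an undefined subterm to a value that is total; hence none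
occurs. -/
theorem Exp.IsCTerm.exists_of_total {s : Exp S (V ⊕ Fin n)} (hs : s.IsCTerm) {θ : V → Exp S V}
    {t : Exp S V} (h : Exp.Approx t.toPartial (s.toPartial.subst (botEnv n θ))) :
    ∃ s₀ : Exp S V, s₀.IsCTerm ∧ s₀.subst θ = t ∧ s = s₀.map .inl := by
  induction hs generalizing t with
  | var x =>
    rcases x with x | i
    · exact ⟨.var x, .var x, (Exp.eq_of_approx_toPartial h).symm, rfl⟩
    · exact (Exp.toPartial_ne_bot _ (Exp.approx_bot_iff.1 h)).elim
  | con c ts _ ih =>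
    rcases Exp.approx_app_iff.1 h with h | ⟨es', h, H⟩
    · exact (Exp.toPartial_ne_bot _ h).elim
    · rcases t with y | ⟨c | f, es⟩
      · cases h
      · cases h
        choose s h1 h2 h3 using fun i => ih i (H i)
        exact ⟨.app (.inl c) s, .con c s h1, congrArg _ (funext h2), congrArg _ (funext h3)⟩
      · cases h

theorem Exp.weaken_toLExp_map_inl (s : Exp S V) :
    (s.map (.inl : V → V ⊕ Fin n)).toLExp.weaken = (s.map .inl).toLExp := by
  rw [LExp.weaken, LExp.bind_toLExp, Exp.map_subst]
  rfl

/-- A peel-normal form with a total value is a value after garbage collection, or its first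
binding that is needed is a call. -/
theorem PeelNF.progress {P : Set (Rule S V)} {e : LExp S V n} (h : PeelNF e) {θ : V → Exp S V}
    (hθ : ∀ x, (θ x).IsCTerm) {K : ℕ} {t : Exp S V} (H : LSem P (botEnv n θ) e K t.toPartial) :
    (∃ s : Exp S V, s.IsCTerm ∧ s.subst θ = t ∧
      Relation.ReflTransGen PeelIn e (s.map .inl).toLExp) ∨
    ∃ (m : ℕ) (C : LCtx S V m n) (f : S.Fun) (ts : Fin (S.arity (.inr f)) → Exp S (V ⊕ Fin m))
      (v : Exp S.withBot V) (k : ℕ), (∀ i, (ts i).IsCTerm) ∧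
      e = C.fill (.app (.inr f) fun i => (ts i).toLExp) ∧ v ≠ Exp.bot ∧
      LSem P (botEnv m θ) (.app (.inr f) fun i => (ts i).toLExp) k v ∧
      ∀ σ : V → Exp S V, (∀ x ∈ e.FV, σ x = θ x) → ∀ (r : LExp S V m) (j : ℕ), j < k →
        LSem P (botEnv m Exp.var) r j v →
        ∃ K' < K, LSem P (botEnv n Exp.var) ((C.subst σ).fill r) K' t.toPartial := by
  induction h generalizing K with
  | cterm s hs =>
    obtain ⟨s₀, h1, h2, rfl⟩ := hs.exists_of_total (LSem.approx hs H)
    exact .inl ⟨s₀, h1, h2, .refl⟩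
  | call f ts hts =>
    exact .inr ⟨_, .hole, f, ts, _, K, hts, rfl, Exp.toPartial_ne_bot _, H,
      fun σ _ r j hj hr => ⟨j, hj, hr⟩⟩
  | @letCall n f ts hts b hb ih =>
    generalize ht : t.toPartial = t' at H
    cases H with
    | bot => exact (Exp.toPartial_ne_bot _ ht).elim
    | @letIn _ _ _ _ u _ k₁ k₂ _ h₁ h₂ hK =>
      subst ht
      -- An undefined binding is skipped, and its variable joins the undefined scope. The first
      -- binding with a defined value is the call to narrow.
      by_cases hu : u = Exp.bot
      · subst hu
        rw [consEnv_botEnv] at h₂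
        rcases ih h₂ with ⟨s, hs, hst, hsteps⟩ | ⟨m, C, g, us, v, k, h1, rfl, h3, h4, h5⟩
        · refine .inl ⟨s, hs, hst, ?_⟩
          refine (Relation.ReflTransGen.lift (p := PeelIn)
            (LExp.letIn (.app (.inr f) fun i => (ts i).toLExp))
            (fun _ _ h => PeelIn.letBody _ h) _ _ hsteps).tail ?_
          rw [← Exp.weaken_toLExp_map_inl s]
          exact (PeelStep.elim _ _).peelIn
        · refine .inr ⟨m, .letBody (.app (.inr f) fun i => (ts i).toLExp) C, g, us, v, k, h1, rfl, h3, h4, fun σ hσ r j hj hr => ?_⟩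
          obtain ⟨K', hK', hsem⟩ := h5 σ (fun x hx => hσ x (Set.mem_union_right _ hx)) r j hj hr
          rw [← consEnv_botEnv] at hsem
          exact ⟨K', by omega, .letIn (.bot _ _ 0) hsem (by omega)⟩
      · refine .inr ⟨n, .letDef .hole b, f, ts, u, k₁, hts, rfl, hu, h₁,
          -- The contractum costs `j < k₁` and the body still `k₂`, so the total falls below `K`.
          fun σ hσ r j hj hr => ⟨j + k₂, by omega, .letIn hr ?_ le_rfl⟩⟩
        refine LSem.bind h₂ (fun x hx => ?_) fun i => ⟨.var _, ?_⟩
        · simp only [Sum.elim_inl, hσ x (Set.mem_union_right _ hx)]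
          refine ⟨(hθ x).map, ?_⟩
          rw [Exp.toPartial_map_subst]
          change Exp.Approx (θ x).toPartial ((θ x).toPartial.subst Exp.var)
          rw [Exp.subst_var]
          exact .refl _
        · exact Fin.cases (.refl _) (fun _ => .refl _) i

/-! ### Matching -/

/-- A linear tuple of matching problems can be solved componentwise. -/
theorem exists_common_of_nodup {k : ℕ} {ps : Fin k → Exp S X}
    (h : (List.ofFn fun i => (ps i).varList).flatten.Nodup) (μ : Fin k → X → A) (d : X → A) :
    ∃ ν : X → A, ∀ i, ∀ x ∈ (ps i).vars, ν x = μ i x := by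
  classical
  have hdisj : ∀ i j, ∀ x ∈ (ps i).vars, x ∈ (ps j).vars → i = j := by
    have hp := (List.nodup_flatten.1 h).2
    rw [List.pairwise_ofFn] at hp
    intro i j x hi hj
    rcases lt_trichotomy i j with hij | hij | hij
    · exact (hp hij hi hj).elim
    · exact hij
    · exact (hp hij hj hi).elim
  refine ⟨fun x => if h : ∃ i, x ∈ (ps i).vars then μ h.choose x else d x, fun i x hx => ?_⟩
  have hex : ∃ i, x ∈ (ps i).vars := ⟨i, hx⟩
  simp only [dif_pos hex]
  rw [hdisj _ _ x hex.choose_spec hx]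

theorem Exp.nodup_of_app {h : S.Sym} {es : Fin (S.arity h) → Exp S X}
    (H : (Exp.app h es).varList.Nodup) (i : Fin (S.arity h)) : (es i).varList.Nodup := by
  rw [varList] at H
  exact (List.nodup_flatten.1 H).1 _ (List.mem_ofFn.2 ⟨i, rfl⟩)

theorem Exp.match_tuple {k : ℕ} {ps : Fin k → Exp S X} {qs : Fin k → Exp S Y}
    {τ : X → Exp S.withBot Z} {ε : Y → Exp S.withBot Z} (d : X → Exp S Y)
    (hlin : (List.ofFn fun i => (ps i).varList).flatten.Nodup)
    (H : ∀ i, ∃ μ : X → Exp S Y, (ps i).subst μ = qs i ∧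
      ∀ x ∈ (ps i).vars, Approx (τ x) ((μ x).toPartial.subst ε)) :
    ∃ μ : X → Exp S Y, ∀ i, (ps i).subst μ = qs i ∧
      ∀ x ∈ (ps i).vars, Approx (τ x) ((μ x).toPartial.subst ε) := by
  choose μ h1 h2 using H
  obtain ⟨ν, hν⟩ := exists_common_of_nodup hlin μ d
  refine ⟨ν, fun i => ⟨?_, fun x hx => ?_⟩⟩
  · rw [← h1 i]
    exact Exp.subst_congr _ (hν i)
  · rw [hν i x hx]
    exact h2 i x hx

/-- If the instance of a linear pattern by partial terms approximates the value of a c-term whose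
variables are variables or undefined, then the c-term is an instance of the pattern. -/
theorem Exp.exists_match {p : Exp S X} (hp : p.IsCTerm) (hlin : p.varList.Nodup)
    {q : Exp S Y} (hq : q.IsCTerm) {τ : X → Exp S.withBot Z} {ε : Y → Exp S.withBot Z}
    (hε : ∀ y, ε y = Exp.bot ∨ ∃ z, ε y = .var z)
    (h : Approx (p.toPartial.subst τ) (q.toPartial.subst ε)) (d : X → Exp S Y) :
    ∃ μ : X → Exp S Y, p.subst μ = q ∧
      ∀ x ∈ p.vars, Approx (τ x) ((μ x).toPartial.subst ε) := by
  induction hp generalizing q with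
  | var x =>
    refine ⟨fun _ => q, rfl, fun y hy => ?_⟩
    rw [mem_vars_var.1 hy]
    exact h
  | con c ps _ ih =>
    cases hq with
    | var y =>
      exfalso
      change Approx _ (ε y) at h
      -- A constructor of the pattern cannot lie below the undefined value or a variable.
      rcases hε y with hy | ⟨z, hy⟩
      · rw [hy, approx_bot_iff] at h
        injection h with h _
        cases h
      · rw [hy, approx_var_iff] at h
        rcases h with h | h
        · injection h with h _
          cases h
        · cases h
    | con c' qs hqs =>
      rcases approx_app_iff.1 h with h | ⟨es, h, H⟩
      · injection h with h _
        cases h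
      · cases h
        obtain ⟨μ, hμ⟩ := match_tuple d hlin fun i => ih i (nodup_of_app hlin i) (hqs i) (H i)
        refine ⟨μ, congrArg _ (funext fun i => (hμ i).1), fun x hx => ?_⟩
        obtain ⟨i, hi⟩ := mem_vars_app.1 hx
        exact (hμ i).2 x hi

/-! ### Fresh names -/

theorem exists_injective_avoiding [Infinite V] {s : Set V} (hs : s.Finite) (m : ℕ) :
    ∃ ν : Fin m → V, Function.Injective ν ∧ Disjoint (Set.range ν) s := by
  have : Infinite (sᶜ : Set V) := hs.infinite_compl.to_subtype
  let f := Infinite.natEmbedding (sᶜ : Set V)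
  refine ⟨fun i => f i, fun i j h => Fin.ext (f.injective (Subtype.ext h)), ?_⟩
  rw [Set.disjoint_left]
  rintro _ ⟨i, rfl⟩
  exact (f i).2

theorem exists_perm_avoiding [Infinite V] (s : Finset V) {B : Set V} (hB : B.Finite) :
    ∃ ρ : Equiv.Perm V, ∀ x ∈ s, ρ x ∉ B := by
  classical
  induction s using Finset.induction_on with
  | empty => exact ⟨1, by simp⟩
  | insert a s ha ih =>
    obtain ⟨ρ, hρ⟩ := ih
    -- `z` also avoids the current images, so that swapping it in leaves the earlier elements alone.
    obtain ⟨z, hz⟩ := (hB.union ((insert a s).image ρ).finite_toSet).infinite_compl.nonempty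
    have hzB : z ∉ B := fun h => hz (Set.mem_union_left _ h)
    have hzs : ∀ x ∈ insert a s, ρ x ≠ z := fun x hx h =>
      hz (Set.mem_union_right _ (Finset.mem_coe.2 (Finset.mem_image.2 ⟨x, hx, h⟩)))
    refine ⟨Equiv.swap (ρ a) z * ρ, fun x hx => ?_⟩
    rw [Equiv.Perm.mul_apply]
    by_cases hxa : x = a
    · rw [hxa, Equiv.swap_apply_left]; exact hzB
    · rw [Equiv.swap_apply_of_ne_of_ne (fun h => hxa (ρ.injective h)) (hzs x hx)]
      exact hρ x ((Finset.mem_insert.1 hx).resolve_left hxa)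

/-! ### Total terms above partial terms -/

/-- Replaces all occurrences of the undefined value by the variable `z`. -/
def Exp.totalise (z : X) : Exp S.withBot X → Exp S X
  | .var x => .var x
  | .app (.inl none) _ => .var z
  | .app (.inl (some c)) es => .app (.inl c) fun i => (es i).totalise z
  | .app (.inr f) es => .app (.inr f) fun i => (es i).totalise z

theorem Exp.IsCTerm.totalise (z : X) {t : Exp S.withBot X} (ht : t.IsCTerm) :
    (t.totalise z).IsCTerm := by
  induction ht with
  | var x => exact .var x
  | con c ts _ ih =>
    rcases c with _ | c
    · exact .var z
    · exact .con c _ ih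

/-- Narrowing substitutions must be total, but the values that CRWL picks for extra variables are
partial. Any total c-term above will do, as `LSem` is monotone in the environment. -/
theorem Exp.approx_totalise (z : X) (t : Exp S.withBot X) :
    Approx t (t.totalise z).toPartial := by
  induction t with
  | var x => exact .var x
  | app h es ih =>
    rcases h with (_ | c) | f
    · rw [app_none_eq_bot]; exact .bot _
    · exact .app _ _ _ ih
    · exact .app _ _ _ ih

theorem Exp.vars_totalise {z : X} {t : Exp S.withBot X} {x : X} (hx : x ∈ (t.totalise z).vars) :
    x = z ∨ x ∈ t.vars := by
  induction t with
  | var y => exact .inr hx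
  | app h es ih =>
    rcases h with (_ | c) | f
    · exact .inl (mem_vars_var.1 hx)
    · obtain ⟨i, hi⟩ := mem_vars_app.1 hx
      exact (ih i hi).imp_right fun h => mem_vars_app.2 ⟨i, h⟩
    · obtain ⟨i, hi⟩ := mem_vars_app.1 hx
      exact (ih i hi).imp_right fun h => mem_vars_app.2 ⟨i, h⟩

/-! ### Completeness of let-narrowing -/

theorem Exp.subst_closeWith (ν : Fin m → V) (σ : X → Exp S V) (e : Exp S X) :
    (e.subst σ).closeWith ν = e.subst fun x => (σ x).closeWith ν :=
  Exp.subst_map _ _ _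

open Classical in
theorem Exp.toPartial_closeWith_subst (ν : Fin m → V) (e : Exp S V) :
    (e.closeWith ν).toPartial.subst (botEnv m Exp.var) =
      e.toPartial.subst fun x => if x ∈ Set.range ν then Exp.bot else .var x := by
  rw [Exp.closeWith, Exp.toPartial_map_subst]
  congr 1
  funext x
  by_cases h : ∃ i, ν i = x
  · rw [dif_pos h, if_pos (Set.mem_range.2 h)]
    rfl
  · rw [dif_neg h, if_neg (fun h' => h (Set.mem_range.1 h'))]
    rfl

/-- A call with a defined value in a scope of undefined variables can be narrowed. -/
theorem exists_letNarrStep [Infinite V] {P : Set (Rule S V)} (hP : IsProgram P)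
    {θ : V → Exp S V} (hθ : IsCSubst θ) {W : Set V} (hW : W.Finite) (C : LCtx S V m 0) {f : S.Fun}
    {ts : Fin (S.arity (.inr f)) → Exp S (V ⊕ Fin m)} (hts : ∀ i, (ts i).IsCTerm)
    (hFV : (C.fill (.app (.inr f) fun i => (ts i).toLExp)).FV ⊆ W) {v : Exp S.withBot V}
    (hv : v ≠ Exp.bot) {k : ℕ}
    (H : LSem P (botEnv m θ) (.app (.inr f) fun i => (ts i).toLExp) k v) :
    ∃ (σ : V → Exp S V) (r : LExp S V m) (j : ℕ), IsCSubst σ ∧ (∀ x ∈ W, σ x = θ x) ∧ j < k ∧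
      LSem P (botEnv m Exp.var) r j v ∧
      LetNarrStep P (C.fill (.app (.inr f) fun i => (ts i).toLExp)) σ ((C.subst σ).fill r) := by
  classical
  cases H with
  | bot => exact (hv rfl).elim
  | @call _ _ R hR τ hτ _ k' j _ _ hargs hrhs hK =>
    -- `β` is `θ` on free variables and keeps the bound ones.
    set β : V ⊕ Fin m → Exp S (V ⊕ Fin m) :=
      Sum.elim (fun x => (θ x).map .inl) fun i => .var (.inr i) with hβ
    have hβc : ∀ x, (β x).IsCTerm := by
      rintro (x | i)
      · exact (hθ.2 x).map
      · exact .var _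
    have hβe : ∀ s : Exp S (V ⊕ Fin m), (s.subst β).toPartial.subst (botEnv m Exp.var) =
        s.toPartial.subst (botEnv m θ) := by
      intro s
      rw [Exp.toPartial_subst, Exp.subst_subst]
      congr 1
      funext x
      rcases x with x | i
      · change ((θ x).map (.inl : V → V ⊕ Fin m)).toPartial.subst _ = _
        rw [Exp.toPartial_map_subst]
        exact Exp.subst_var _
      · rfl
    have hlin : (List.ofFn fun i => (R.args i).varList).flatten.Nodup := by
      have := (hP R hR).2
      rwa [Rule.lhs, Exp.varList] at this
    obtain ⟨μ, hμ⟩ := Exp.match_tuple (τ := τ) (ε := botEnv m (Exp.var : V → Exp S V))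
      (ps := R.args) (qs := fun i => (ts i).subst β) (fun x => .var (.inl x)) hlin fun i => by
        refine Exp.exists_match ((hP R hR).1 i) (Exp.nodup_of_app (hP R hR).2 i)
          ((hts i).subst fun x _ => hβc x) ?_ ?_ fun x => .var (.inl x)
        · rintro (x | i)
          · exact .inr ⟨x, rfl⟩
          · exact .inl rfl
        · rw [hβe]
          exact LSem.approx (hts i) (hargs i)
    obtain ⟨z⟩ : Nonempty V := inferInstance
    set D : Set V := W ∪ substDom θ with hD
    have hDfin : D.Finite := hW.union hθ.1
    -- All names that bound variables and the rule variant must avoid: those of the expression and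
    -- of `θ`, those in the values of the rule variables, and the filler `z`.
    set B : Set V := D ∪ (⋃ x ∈ D, (θ x).vars) ∪ (⋃ y ∈ R.vars, (τ y).vars) ∪ {z} with hB
    have hBfin : B.Finite :=
      ((hDfin.union (hDfin.biUnion fun x _ => Exp.finite_vars _)).union
        (R.finite_vars.biUnion fun y _ => Exp.finite_vars _)).union (Set.finite_singleton z)
    have hBD : ∀ x ∈ D, x ∈ B := fun x hx =>
      Set.mem_union_left _ (Set.mem_union_left _ (Set.mem_union_left _ hx))
    have hBθ : ∀ x ∈ D, ∀ y ∈ (θ x).vars, y ∈ B := fun x hx y hy =>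
      Set.mem_union_left _ (Set.mem_union_left _ (Set.mem_union_right _
        (Set.mem_biUnion hx hy)))
    have hBτ : ∀ x ∈ R.vars, ∀ y ∈ (τ x).vars, y ∈ B := fun x hx y hy =>
      Set.mem_union_left _ (Set.mem_union_right _ (Set.mem_biUnion hx hy))
    have hBz : z ∈ B := Set.mem_union_right _ rfl
    obtain ⟨ν, hν, hνB⟩ := exists_injective_avoiding hBfin m
    have hνB' : ∀ x ∈ B, x ∉ Set.range ν := fun x hx h => Set.disjoint_left.1 hνB h hx
    obtain ⟨ρ, hρ⟩ := exists_perm_avoiding R.finite_vars.toFinset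
      (hBfin.union (Set.finite_range ν))
    have hρ' : ∀ x ∈ B ∪ Set.range ν, ρ.symm x ∉ R.vars := fun x hx h =>
      hρ _ (R.finite_vars.mem_toFinset.2 h) (by rwa [Equiv.apply_symm_apply])
    have hl : ∀ {y}, y ∈ R.lhs.vars → y ∈ R.vars := fun h => Set.mem_union_left _ h
    have hr : ∀ {y}, y ∈ R.rhs.vars → y ∈ R.vars := fun h => Set.mem_union_right _ h
    set op : V ⊕ Fin m → V := Sum.elim id ν with hop
    -- Three cases: the match for variables of the renamed left-hand side, a totalised value for
    -- extra variables, and `θ` elsewhere, in particular on `W`.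
    set σ : V → Exp S V := fun x => if ρ.symm x ∈ R.lhs.vars then (μ (ρ.symm x)).map op else
      if ρ.symm x ∈ R.rhs.vars then (τ (ρ.symm x)).totalise z else θ x with hσdef
    have hσl : ∀ y ∈ R.lhs.vars, σ (ρ y) = (μ y).map op := fun y hy => by
      simp only [hσdef, Equiv.symm_apply_apply, if_pos hy]
    have hσr : ∀ y ∈ R.rhs.vars, y ∉ R.lhs.vars → σ (ρ y) = (τ y).totalise z := fun y hy hy' => by
      simp only [hσdef, Equiv.symm_apply_apply, if_pos hy, if_neg hy']
    have hσθ : ∀ x, ρ.symm x ∉ R.vars → σ x = θ x := fun x hx => by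
      simp only [hσdef, if_neg fun h => hx (hl h), if_neg fun h => hx (hr h)]
    have hσB : ∀ x ∈ B ∪ Set.range ν, σ x = θ x := fun x hx => hσθ x (hρ' x hx)
    have hμc : ∀ y ∈ R.lhs.vars, (μ y).IsCTerm := by
      intro y hy
      obtain ⟨i, hi⟩ := Exp.mem_vars_app.1 hy
      have : ((R.args i).subst μ).IsCTerm := by
        rw [(hμ i).1]; exact (hts i).subst fun x _ => hβc x
      exact this.of_subst y hi
    have htsW : ∀ i x, .inl x ∈ (ts i).vars → x ∈ W := fun i x hx =>
      hFV (C.FV_subset_fill _ (LExp.mem_FV_app.2 ⟨i, LExp.mem_FV_toLExp.2 hx⟩))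
    have hμν : ∀ y ∈ R.lhs.vars, ∀ x, .inl x ∈ (μ y).vars → x ∉ Set.range ν := by
      intro y hy x hx
      obtain ⟨i, hi⟩ := Exp.mem_vars_app.1 hy
      have hx' : .inl x ∈ ((R.args i).subst μ).vars := Exp.mem_vars_subst.2 ⟨y, hi, hx⟩
      rw [(hμ i).1] at hx'
      obtain ⟨w | l, hw, hxw⟩ := Exp.mem_vars_subst.1 hx'
      · obtain ⟨x', hx', h⟩ := Exp.mem_vars_map.1 hxw
        cases h
        exact hνB' x (hBθ w (Set.mem_union_left _ (htsW i w hw)) x hx')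
      · cases Exp.mem_vars_var.1 hxw
    have hσc : ∀ x, (σ x).IsCTerm := by
      intro x
      by_cases h1 : ρ.symm x ∈ R.lhs.vars
      · have := hσl _ h1
        rw [Equiv.apply_symm_apply] at this
        rw [this]; exact (hμc _ h1).map
      by_cases h2 : ρ.symm x ∈ R.rhs.vars
      · have := hσr _ h2 h1
        rw [Equiv.apply_symm_apply] at this
        rw [this]; exact (hτ _).totalise z
      · rw [hσθ x fun h => (Set.mem_or_mem_of_mem_union h).elim h1 h2]; exact hθ.2 x
    have hσ : IsCSubst σ := by
      refine ⟨(hθ.1.union (R.finite_vars.image ρ)).subset fun x hx => ?_, hσc⟩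
      by_cases h : ρ.symm x ∈ R.vars
      · exact Set.mem_union_right _ ⟨_, h, ρ.apply_symm_apply x⟩
      · refine Set.mem_union_left _ fun h' => hx ?_
        rw [hσθ x h, h']
    have hθν : ∀ i, θ (ν i) = .var (ν i) := fun i => by
      by_contra h
      exact hνB' (ν i) (hBD _ (Set.mem_union_right _ h)) ⟨i, rfl⟩
    have hσν : ∀ i, σ (ν i) = .var (ν i) := fun i => by
      rw [hσB _ (Set.mem_union_right _ ⟨i, rfl⟩), hθν i]
    have hσW : ∀ x ∈ W, σ x = θ x := fun x hx =>
      hσB x (Set.mem_union_left _ (hBD x (Set.mem_union_left _ hx)))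
    have hfreshB : ∀ x ∈ B ∪ Set.range ν, x ∉ (R.rename ρ).vars := fun x hx h =>
      hρ' x hx (Rule.mem_vars_rename.1 h)
    refine ⟨σ, (((R.rename ρ).rhs.subst σ).closeWith ν).toLExp, j, hσ, hσW, by omega, ?_, ?_⟩
    · have hrhs' : (((R.rename ρ).rhs.subst σ).closeWith ν).toLExp =
          R.rhs.inLExp.bind (Sum.elim (fun y => (σ (ρ y)).closeWith ν) Fin.elim0) := by
        rw [Exp.inLExp, LExp.bind_toLExp, Exp.map_subst, Exp.subst_closeWith]
        exact congrArg Exp.toLExp (Exp.map_subst _ _ _)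
      rw [hrhs']
      refine LSem.bind hrhs (fun y hy => ?_) fun i => i.elim0
      obtain ⟨y', hy', h⟩ := Exp.mem_vars_map.1 (LExp.mem_FV_toLExp.1 hy)
      cases h
      refine ⟨(hσc _).map, ?_⟩
      simp only [Sum.elim_inl]
      rw [Exp.toPartial_closeWith_subst]
      by_cases hyl : y ∈ R.lhs.vars
      · obtain ⟨i, hi⟩ := Exp.mem_vars_app.1 hyl
        rw [hσl y hyl, Exp.toPartial_map_subst]
        convert (hμ i).2 y hi using 1
        refine Exp.subst_congr _ fun w hw => ?_
        rw [Exp.vars_toPartial] at hw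
        rcases w with x | l
        · exact if_neg (hμν y hyl x hw)
        · exact if_pos ⟨l, rfl⟩
      · rw [hσr y hy' hyl, Exp.subst_eq_self]
        · exact Exp.approx_totalise z _
        · intro x hx
          rw [Exp.vars_toPartial] at hx
          refine if_neg (hνB' x ?_)
          rcases Exp.vars_totalise hx with rfl | hx
          · exact hBz
          · exact hBτ y (hr hy') x hx
    · refine LetNarrStep.narr C R (R.rename ρ) hR ⟨ρ, rfl⟩ (fun i => (ts i).toLExp) ν hν ?_ ?_ σ hσ
        ?_ ?_ ?_
      · exact Set.disjoint_left.2 fun x hx hx' =>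
          hνB' x (hBD x (Set.mem_union_left _ (hFV hx'))) hx
      · refine Set.disjoint_left.2 fun x hx hx' => hfreshB x ?_ hx
        rcases hx' with hx' | hx'
        · exact Set.mem_union_left _ (hBD x (Set.mem_union_left _ (hFV hx')))
        · exact Set.mem_union_right _ hx'
      · refine congrArg (LExp.app _) (funext fun i => ?_)
        change (((ts i).toLExp.bind _).bind _) = (((((R.args i).map ρ).subst σ).map _).toLExp)
        rw [LExp.bind_toLExp, LExp.bind_toLExp]
        congr 1
        rw [Exp.subst_subst, Exp.map_subst, Exp.subst_congr (R.args i) fun y hy =>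
          hσl y (Exp.mem_vars_app.2 ⟨i, hy⟩), ← Exp.subst_map, (hμ i).1, Exp.subst_map,
          Exp.subst_map]
        refine Exp.subst_congr _ fun w hw => ?_
        rcases w with x | l
        · simp only [Exp.subst, Sum.elim_inl, hσW x (htsW i x hw), hβ, Exp.map_map, hop, id]
        · simp only [Exp.subst, Sum.elim_inl, Sum.elim_inr, hσν, hβ]
          rfl
      · exact Set.disjoint_left.2 fun x hx ⟨i, hi⟩ => hx (hi ▸ hσν i)
      · intro x hx hxl
        rw [Rule.mem_lhs_vars_rename] at hxl
        refine Set.disjoint_left.2 fun w hw => hνB' w ?_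
        by_cases h2 : ρ.symm x ∈ R.rhs.vars
        · have := hσr _ h2 hxl
          rw [Equiv.apply_symm_apply] at this
          rw [this] at hw
          rcases Exp.vars_totalise hw with rfl | hw
          · exact hBz
          · exact hBτ _ (hr h2) w hw
        · have h := hσθ x fun h => (Set.mem_or_mem_of_mem_union h).elim hxl h2
          rw [h] at hw
          refine hBθ x (Set.mem_union_right _ fun h' => hx ?_) w hw
          rw [h, h']

theorem LetNarrSteps.head_peelIn {P : Set (Rule S V)} {a b c : LExp S V 0} {σ : V → Exp S V}
    (h : PeelIn a b) (H : LetNarrSteps P b σ c) : LetNarrSteps P a σ c :=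
  .head h.letNarrStep H

theorem LetNarrSteps.of_peelIn {P : Set (Rule S V)} {a b : LExp S V 0}
    (h : Relation.ReflTransGen PeelIn a b) : LetNarrSteps P a Exp.var b := by
  induction h using Relation.ReflTransGen.head_induction_on with
  | refl => exact .refl _
  | head h _ ih => exact ih.head_peelIn h

/-- Completeness of let-narrowing: every total value of an instance is found. -/
theorem LSem.exists_letNarrSteps [Infinite V] {P : Set (Rule S V)} (hP : IsProgram P)
    {t : Exp S V} (K : ℕ) (e : LExp S V 0) {θ : V → Exp S V} (hθ : IsCSubst θ) {W : Set V}
    (hW : W.Finite) (hFV : e.FV ⊆ W) (H : LSem P (botEnv 0 θ) e K t.toPartial) :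
    ∃ (t' : Exp S V) (σ θ' : V → Exp S V), t'.IsCTerm ∧ IsCSubst σ ∧ IsCSubst θ' ∧
      LetNarrSteps P e σ t'.inLExp ∧ t'.subst θ' = t ∧ ∀ x ∈ W, (σ x).subst θ' = θ x := by
  induction K using Nat.strong_induction_on generalizing e θ W with
  | _ K ihK =>
  induction hw : e.weight using Nat.strong_induction_on generalizing e W with
  | _ w ihw =>
  rcases PeelNF.or_peelIn e with hnf | ⟨e', he'⟩
  · rcases hnf.progress hθ.2 H with ⟨s, hs, hst, hsteps⟩ | ⟨m, C, f, ts, v, k, hts, rfl, hv, hk, h⟩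
    · exact ⟨s, Exp.var, θ, hs, isCSubst_var, hθ, .of_peelIn hsteps, hst, fun _ _ => rfl⟩
    · obtain ⟨σ, r, j, hσ, hσW, hj, hr, hstep⟩ := exists_letNarrStep hP hθ hW C hts hFV hv hk
      obtain ⟨K', hK', hsem⟩ := h σ (fun x hx => hσW x (hFV hx)) r j hj hr
      -- All of `θ` has been applied, so the rest runs with the identity. The new set contains the
      -- variables of each `θ x`, on which `σ'θ'` must be the identity for the composition to give
      -- back `θ`.
      obtain ⟨t', σ', θ', h1, h2, h3, h4, h5, h6⟩ := ihK K' hK' _ isCSubst_var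
        ((hW.biUnion fun x _ => Exp.finite_vars (θ x)).union (LExp.finite_FV _))
        (Set.subset_union_right) hsem
      refine ⟨t', substComp σ σ', θ', h1, hσ.comp h2, h3, .head hstep h4, h5, fun x hx => ?_⟩
      rw [substComp, Exp.subst_subst, hσW x hx]
      exact Exp.subst_eq_self _ fun y hy =>
        h6 y (Set.mem_union_left _ (Set.mem_biUnion hx hy))
  -- A peeling step keeps the bound `K` and lowers the weight; `W` is retained because peeling may
  -- lose variables.
  · obtain ⟨t', σ, θ', h1, h2, h3, h4, h5, h6⟩ := ihw _ (hw ▸ he'.weight_lt) e'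
      (hW.union e'.finite_FV) Set.subset_union_right (he'.lSem H) rfl
    exact ⟨t', σ, θ', h1, h2, h3, h4.head_peelIn he', h5,
      fun x hx => h6 x (Set.mem_union_left _ hx)⟩

theorem CRWLDeterministic.exists_letNarrSteps [Infinite V] {P : Set (Rule S V)}
    (hdet : CRWLDeterministic P) (hP : IsProgram P) {e t : Exp S V} (ht : t.IsCTerm)
    {θ : V → Exp S V} (hθ : IsCSubst θ) (H : RwSteps P (e.subst θ) t) :
    ∃ (t' : Exp S V) (σ θ' : V → Exp S V), t'.IsCTerm ∧ IsCSubst σ ∧ IsCSubst θ' ∧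
      LetNarrSteps P e.inLExp σ t'.inLExp ∧ t'.subst θ' = t ∧
      ∀ x ∈ e.vars, (σ x).subst θ' = θ x := by
  have h := hdet.crwl_of_rwSteps hP ht H
  obtain ⟨K, hK⟩ := h.exists_lSem e (fun x => (θ x).toPartial) (fun x => (hθ.2 x).toPartial)
    (Exp.toPartial_subst θ e)
  rw [← botEnv_zero] at hK
  refine LSem.exists_letNarrSteps hP K _ hθ e.finite_vars (fun x hx => ?_) hK
  obtain ⟨y, hy, h⟩ := Exp.mem_vars_map.1 (LExp.mem_FV_toLExp.1 hx)
  cases h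
  exact hy

end LetNarrowing

/-! ### The theorem -/

theorem mainTheorem10 {S : LetNarrowing.Signature} {V : Type*} [Infinite V] [Countable V]
    (P : Set (LetNarrowing.Rule S V)) (hP : LetNarrowing.IsProgram P)
    (e t : LetNarrowing.Exp S V) (ht : t.IsCTerm) :
    (∀ θ : V → LetNarrowing.Exp S V, LetNarrowing.IsCSubst θ →
      LetNarrowing.LetNarrSteps P e.inLExp θ t.inLExp →
        LetNarrowing.RwSteps P (e.subst θ) t) ∧
    (LetNarrowing.CRWLDeterministic P →
      (∀ θ : V → LetNarrowing.Exp S V, LetNarrowing.IsCSubst θ →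
        LetNarrowing.RwSteps P (e.subst θ) t →
          ∃ (t' : LetNarrowing.Exp S V) (σ θ' : V → LetNarrowing.Exp S V),
            t'.IsCTerm ∧ LetNarrowing.IsCSubst σ ∧ LetNarrowing.IsCSubst θ' ∧
            LetNarrowing.LetNarrSteps P e.inLExp σ t'.inLExp ∧
            t'.subst θ' = t ∧ ∀ x ∈ e.vars, (σ x).subst θ' = θ x) ∧
      (∀ θ : V → LetNarrowing.Exp S V, (∀ x ∈ e.vars, (θ x).IsCTerm) →
        LetNarrowing.NarrSteps P e θ t →
          ∃ (t' : LetNarrowing.Exp S V) (σ θ' : V → LetNarrowing.Exp S V),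
            t'.IsCTerm ∧ LetNarrowing.IsCSubst σ ∧ LetNarrowing.IsCSubst θ' ∧
            LetNarrowing.LetNarrSteps P e.inLExp σ t'.inLExp ∧
            t'.subst θ' = t ∧ ∀ x ∈ e.vars, (σ x).subst θ' = θ x)) := by
  refine ⟨fun θ _ h => h.rwSteps, fun hdet =>
    ⟨fun θ hθ h => hdet.exists_letNarrSteps hP ht hθ h, fun θ hθ h => ?_⟩⟩
  -- The narrowing substitution need not be a c-substitution outside `e`; its restriction to the
  -- variables of `e` is one and gives the same instance.
  have hrestr : ∀ x ∈ e.vars, LetNarrowing.restrictSubst e.vars θ x = θ x := fun x hx =>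
    LetNarrowing.restrictSubst_of_mem hx
  have hrw := h.rwSteps
  rw [← LetNarrowing.Exp.subst_congr e hrestr] at hrw
  obtain ⟨t', σ, θ', h1, h2, h3, h4, h5, h6⟩ := hdet.exists_letNarrSteps hP ht
    (LetNarrowing.isCSubst_restrictSubst e.finite_vars hθ) hrw
  exact ⟨t', σ, θ', h1, h2, h3, h4, h5, fun x hx => (h6 x hx).trans (hrestr x hx)⟩
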